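/- **Model.** Let $(\eta_{k,\ell})_{k\ge 1,\ell\ge 0}$ be independent standard normal random variables on a probability space $(\Omega,\mathcal F,\mathsf P)$, let $\mathcal F_0$ be the trivial $\sigma$-algebra and $\mathcal F_k=\sigma(\eta_{i,j}:1\le i\le k,\ j\ge 0)$ for $k\ge1$. For $\varrho\in\mathbb R$ let $S$ be the doubly geometric spatial autoregressive field $$S_{k,\ell}=S_{k-1,\ell}+\varrho S_{k,\ell-1}-\varrho S_{k-1,\ell-1}+\eta_{k,\ell}\quad(k\ge1,\ \ell\ge0),\qquad S_{k,-1}=S_{0,\ell}=S_{0,-1}=0,$$ and put $\Delta_1S_{k,\ell}=S_{k+1,\ell}-S_{k,\ell}$. The forward rates $f_{k,\ell}$ ($k,\ell\ge0$) have a given deterministic initial curve $(f_{0,\ell})_{\ell\ge0}$ and satisfy $f_{k+1,\ell}=f_{k,\ell}+\alpha_{k,\ell}+\beta\,\Delta_1S_{k,\ell}$ with $\mathcal F_k$-measurable drifts $\alpha_{k,\ell}$. Zero coupon bond prices are $P_{k,\ell}=\exp\{-\sum_{j=0}^{\ell-k-1}f_{k,j}\}$ for $0\le k\le\ell$. For an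 integer $J\ge0$ and $\mathbf b=(b_0,\dots,b_J)\in\mathbb R^{J+1}$ the stochastic discount factors are $M_0=1$, $$M_{k+1}=M_k\,e^{-f_{k,0}}\,\frac{\exp\{\sum_{j=0}^Jb_j\Delta_1S_{k,j}\}}{\mathsf E(\exp\{\sum_{j=0}^Jb_j\Delta_1S_{k,j}\}\mid\mathcal F_k)} .$$ The model with parameters $(\beta,\varrho,\mathbf b)$ is assumed to be free of arbitrage in the sense that for every $\ell\ge1$ the process $(M_kP_{k,\ell})_{0\le k\le\ell}$ is a martingale with respect to $(\mathcal F_k)$. **Likelihood.** For $K,L\ge1$ the log-likelihood function of the sample $(x_{k,\ell})_{1\le k\le K,\,0\le\ell\le L}$, with $x_{0,\ell}:=f_{0,\ell}$, is $$\begin{aligned}\mathcal L_{K,L}(x;\beta,\varrho,\mathbf b)={}&-\frac{K(L+1)}2\log(2\pi\beta^2)-\frac12\log(K!)\\&-\frac1{2\beta^2}\sum_{k=1}^K\sum_{\ell=0}^{L-1}\Big(y_{k,\ell}(\varrho)-\frac{\beta^2}2\sum_{i=0}^{2\ell}\varrho^i+\beta\sum_{j=\ell}^Jb_j\varrho^{j-\ell}\Big)^2\\&-\frac1{2\beta^2}\sum_{k=1}^K\frac1k\Big(\widetilde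 y_{k,L}(\varrho)-\frac{\beta^2}2\sum_{j=1}^k\sum_{i=0}^{2(k+L-j)}\varrho^i+\beta\sum_{j=0}^Jb_jq_{j,k,L}\Big)^2,\end{aligned}$$ where $y_{k,\ell}(\varrho)=x_{k,\ell}-x_{k-1,\ell+1}-\varrho(x_{k,\ell-1}-x_{k-1,\ell})$ for $\ell\ge1$, $y_{k,0}(\varrho)=x_{k,0}-x_{k-1,1}$, $\widetilde y_{k,L}(\varrho)=x_{k,L}-x_{0,k+L}-\varrho(x_{k,L-1}-x_{0,k+L-1})$, and $q_{j,k,L}=\sum_{n=\max(0,\,j-k-L+1)}^{j-L}\varrho^n$ if $j\ge L$, $q_{j,k,L}=0$ otherwise. **Theorem.** Let $H\subset\mathbb R^{J+3}$ be a compact set such that $\beta\ne0$ and $\varrho\in(-1,1)$ for all $(\beta,\varrho,\mathbf b)\in H$. Let the forward rates $f$ follow the model above with true parameters $(\beta_0,\varrho_0,\mathbf b_0)\in H$, and suppose that $(-\beta_0,\varrho_0,-\mathbf b_0)\notin H$ (which is automatic if $\beta$ has constant sign on $H$, for instance $\beta>0$). Let $K_n,L_n$ ($n\ge1$) be positive integers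 with $K_n=nK+o(n)$ and $L_n=nL+o(n)$ as $n\to\infty$ for some $K>0$, $L>0$. For each $n\ge1$ let $(\widehat\beta_n,\widehat\varrho_n,\widehat{\mathbf b}_n)$ be a maximum likelihood estimator, i.e. a.s. a maximiser over $H$ of $(\beta,\varrho,\mathbf b)\mapsto\mathcal L_{K_n,L_n}\big((f_{k,\ell})_{1\le k\le K_n,\,0\le\ell\le L_n};\beta,\varrho,\mathbf b\big)$. Then $$(\widehat\beta_n,\widehat\varrho_n,\widehat{\mathbf b}_n)\to(\beta_0,\varrho_0,\mathbf b_0)\qquad\text{a.s. as }n\to\infty.$$ -/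

import Mathlib

open MeasureTheory ProbabilityTheory Filter Topology

noncomputable section

namespace HJM

/-- Parameters `(β, ϱ, b₀, …, b_J)`: volatility, autoregression parameter, market prices of risk. -/
abbrev Param (J : ℕ) : Type := ℝ × ℝ × (Fin (J + 1) → ℝ)

section Model

variable {Ω : Type*}

/-- The doubly geometric spatial autoregressive field
`S k ℓ = S (k-1) ℓ + ϱ S k (ℓ-1) - ϱ S (k-1) (ℓ-1) + η k ℓ`, `k ≥ 1`, `ℓ ≥ 0`,
with zero boundary values at `k = 0` and at `ℓ = -1`. -/
def field (ϱ : ℝ) (η : ℕ → ℕ → Ω → ℝ) : ℕ → ℕ → Ω → ℝ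
  | 0, _ => fun _ => 0
  | k + 1, 0 => fun ω => field ϱ η k 0 ω + η (k + 1) 0 ω
  | k + 1, ℓ + 1 => fun ω =>
      field ϱ η k (ℓ + 1) ω + ϱ * field ϱ η (k + 1) ℓ ω - ϱ * field ϱ η k ℓ ω
        + η (k + 1) (ℓ + 1) ω

/-- `Δ₁ S k ℓ = S (k+1) ℓ - S k ℓ`. -/
def fieldIncr (ϱ : ℝ) (η : ℕ → ℕ → Ω → ℝ) (k ℓ : ℕ) (ω : Ω) : ℝ :=
  field ϱ η (k + 1) ℓ ω - field ϱ η k ℓ ω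

/-- Forward rates: `f (k+1) ℓ = f k ℓ + α k ℓ + β Δ₁ S k ℓ`, with initial curve `f₀`;
here `ℓ` is the time to maturity. -/
def forwardRate (β ϱ : ℝ) (f₀ : ℕ → ℝ) (α η : ℕ → ℕ → Ω → ℝ) : ℕ → ℕ → Ω → ℝ
  | 0, ℓ => fun _ => f₀ ℓ
  | k + 1, ℓ => fun ω =>
      forwardRate β ϱ f₀ α η k ℓ ω + α k ℓ ω + β * fieldIncr ϱ η k ℓ ω

/-- Price at time `k` of the zero coupon bond with maturity date `ℓ ≥ k`:
`exp (-(f k 0 + ⋯ + f k (ℓ-k-1)))`. -/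
def bondPrice (f : ℕ → ℕ → Ω → ℝ) (k ℓ : ℕ) (ω : Ω) : ℝ :=
  Real.exp (-∑ j ∈ Finset.range (ℓ - k), f k j ω)

/-- The σ-algebra generated by `η i j`, `1 ≤ i ≤ k`, `j ≥ 0` (trivial for `k = 0`). -/
abbrev pastSigma (η : ℕ → ℕ → Ω → ℝ) (k : ℕ) : MeasurableSpace Ω :=
  ⨆ i ∈ Finset.Icc 1 k, ⨆ j : ℕ, MeasurableSpace.comap (η i j) inferInstance

/-- `exp (∑_{j=0}^J b_j Δ₁ S k j)`. -/
def riskFactor {J : ℕ} (ϱ : ℝ) (b : Fin (J + 1) → ℝ) (η : ℕ → ℕ → Ω → ℝ) (k : ℕ) (ω : Ω) : ℝ :=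
  Real.exp (∑ j : Fin (J + 1), b j * fieldIncr ϱ η k j ω)

variable [MeasurableSpace Ω]

/-- The stochastic discount factors: `M 0 = 1` and
`M (k+1) = M k * exp (-f k 0) * R k / E(R k | 𝓕 k)` where `R k` is the risk factor. -/
def discountFactor {J : ℕ} (P : Measure Ω) (ϱ : ℝ) (b : Fin (J + 1) → ℝ)
    (f η : ℕ → ℕ → Ω → ℝ) : ℕ → Ω → ℝ
  | 0 => fun _ => 1
  | k + 1 => fun ω =>
      discountFactor P ϱ b f η k ω * Real.exp (-f k 0 ω) *
        (riskFactor ϱ b η k ω / (P[riskFactor ϱ b η k | pastSigma η k]) ω)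

/-- `(η k ℓ)_{k ≥ 1, ℓ ≥ 0}` are independent standard normal random variables
(the values `η 0 ℓ` play no role). -/
structure IsStandardNormalNoise (P : Measure Ω) (η : ℕ → ℕ → Ω → ℝ) : Prop where
  measurable : ∀ k ℓ, 1 ≤ k → Measurable (η k ℓ)
  law : ∀ k ℓ, 1 ≤ k → P.map (η k ℓ) = gaussianReal 0 1
  indep : iIndepFun (fun p : ℕ+ × ℕ => η p.1 p.2) P

/-- The martingale (no-arbitrage) condition: for every maturity `ℓ ≥ 1` the discounted bond price
process `(M k * P k ℓ)_{0 ≤ k ≤ ℓ}` is a martingale for the filtration of the noise. -/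
def NoArbitrage {J : ℕ} (P : Measure Ω) (ϱ : ℝ) (b : Fin (J + 1) → ℝ)
    (f η : ℕ → ℕ → Ω → ℝ) : Prop :=
  ∀ ℓ : ℕ, 1 ≤ ℓ →
    (∀ k ≤ ℓ, Integrable (fun ω => discountFactor P ϱ b f η k ω * bondPrice f k ℓ ω) P) ∧
    ∀ i k, i ≤ k → k ≤ ℓ →
      P[fun ω => discountFactor P ϱ b f η k ω * bondPrice f k ℓ ω | pastSigma η i]
        =ᵐ[P] fun ω => discountFactor P ϱ b f η i ω * bondPrice f i ℓ ω

/-- `f` is the forward rate field of a no-arbitrage HJM model with parameters `θ = (β, ϱ, b)`,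
initial curve `f₀` and noise `η`: the noise is standard normal, the drifts `α k ℓ` are
`𝓕 k`-measurable, `f` follows the forward rate dynamics, and the martingale condition holds. -/
structure IsModel {J : ℕ} (P : Measure Ω) (θ : Param J) (f₀ : ℕ → ℝ)
    (α η f : ℕ → ℕ → Ω → ℝ) : Prop where
  noise : IsStandardNormalNoise P η
  drift : ∀ k ℓ, Measurable[pastSigma η k] (α k ℓ)
  dynamics : f = forwardRate θ.1 θ.2.1 f₀ α η
  noArbitrage : NoArbitrage P θ.2.1 θ.2.2 f η

end Model

section Likelihood

/-- `y k ℓ (ϱ) = x k ℓ - x (k-1) (ℓ+1) - ϱ (x k (ℓ-1) - x (k-1) ℓ)` for `ℓ ≥ 1` and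
`y k 0 = x k 0 - x (k-1) 1`; used for `k ≥ 1` only. -/
def y (x : ℕ → ℕ → ℝ) (ϱ : ℝ) (k : ℕ) : ℕ → ℝ
  | 0 => x k 0 - x (k - 1) 1
  | ℓ + 1 => x k (ℓ + 1) - x (k - 1) (ℓ + 2) - ϱ * (x k ℓ - x (k - 1) (ℓ + 1))

/-- `ỹ k L (ϱ) = x k L - x 0 (k+L) - ϱ (x k (L-1) - x 0 (k+L-1))`; used for `k, L ≥ 1` only. -/
def yTilde (x : ℕ → ℕ → ℝ) (ϱ : ℝ) (k L : ℕ) : ℝ :=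
  x k L - x 0 (k + L) - ϱ * (x k (L - 1) - x 0 (k + L - 1))

/-- `q j k ℓ = ∑ ϱ ^ n` over `max 0 (j-k-ℓ+1) ≤ n ≤ j-ℓ` if `j ≥ ℓ`, and `0` otherwise. The
truncated subtraction `j + 1 - (k + ℓ)` is the maximum with `0`. -/
def q (ϱ : ℝ) (j k ℓ : ℕ) : ℝ :=
  if ℓ ≤ j then ∑ n ∈ Finset.Icc (j + 1 - (k + ℓ)) (j - ℓ), ϱ ^ n else 0

/-- The log-likelihood of the parameters `(β, ϱ, b)` given the observations `x k ℓ`,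
`1 ≤ k ≤ K`, `0 ≤ ℓ ≤ L`, where `x 0 ℓ` is the known initial curve; for `K, L ≥ 1`. -/
def logLikelihood {J : ℕ} (K L : ℕ) (x : ℕ → ℕ → ℝ) (β ϱ : ℝ)
    (b : Fin (J + 1) → ℝ) : ℝ :=
  - ((K : ℝ) * ((L : ℝ) + 1) / 2) * Real.log (2 * Real.pi * β ^ 2)
  - 1 / 2 * Real.log (K.factorial : ℝ)
  - 1 / (2 * β ^ 2) * ∑ k ∈ Finset.Icc 1 K, ∑ ℓ ∈ Finset.range L,
      (y x ϱ k ℓ - β ^ 2 / 2 * ∑ i ∈ Finset.range (2 * ℓ + 1), ϱ ^ i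
        + β * ∑ j : Fin (J + 1), if ℓ ≤ (j : ℕ) then b j * ϱ ^ ((j : ℕ) - ℓ) else 0) ^ 2
  - 1 / (2 * β ^ 2) * ∑ k ∈ Finset.Icc 1 K, 1 / (k : ℝ) *
      (yTilde x ϱ k L
        - β ^ 2 / 2 * ∑ j ∈ Finset.Icc 1 k, ∑ i ∈ Finset.range (2 * (k + L - j) + 1), ϱ ^ i
        + β * ∑ j : Fin (J + 1), b j * q ϱ j k L) ^ 2

/-- `θ` is a maximum likelihood estimate over `H` from the observations `x`. -/
def IsMLE {J : ℕ} (H : Set (Param J)) (K L : ℕ) (x : ℕ → ℕ → ℝ) (θ : Param J) : Prop :=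
  θ ∈ H ∧ IsMaxOn (fun τ : Param J => logLikelihood K L x τ.1 τ.2.1 τ.2.2) H θ

end Likelihood

end HJM

end

/-! Under no arbitrage the drift is forced. Comparing the discounted bond prices at times `k` and `k
+ 1` for two consecutive maturities shows that the increment `f (k + 1) ℓ - f k (ℓ + 1)` is an AR(1)
sequence in `ℓ` with inputs `innovationMean θ₀ ℓ + β₀ η (k + 1) ℓ` (`IsModel.forward_increment`).
The residuals in the likelihood are therefore affine in the noise, and the boundary residuals
telescope into sums along antidiagonals. Hence the likelihood is a Gaussian one whose quadratic part
is the bilinear form `pairing` (`logLikelihood_eq`).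

If `θ` is at least as likely as `θ₀`, then `basic_inequality` and
`ParamBounds.exists_quadratic_bound` bound a curvature term by noise statistics. Write `g = β² -
β₀²` and `d = ϱ - ϱ₀`, and let `m` be the sum of the squared mean gaps over the first `J + 1`
maturities. The curvature is of order `n² (g² + d²) + n m`: all observations inform about `β²` and
`ϱ`, but the effect of `b` on the means vanishes for `ℓ > J`, so only about `n` observations inform
about `b`. The cross terms split in the same way. The part of the mean gap that persists as `ℓ → ∞`
is `O(|g| + |d|)`, and it meets statistics of size `o(n^{3/2})`. The rest decays geometrically,
uniformly over `H`, and contributes `o(n)`. Completing the square (`quadratic_absorb`) gives `g² +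
d² + m → 0`.

The estimator depends on the noise, so all noise bounds must be uniform in `θ`; they are, because
`θ` enters only through scalar coefficients and through a uniform geometric envelope. The limits in
`NoiseLimits` follow from `L⁴` bounds: after normalisation each norm is `O(n^{-1/2})`, so fourth
moments are `O(n⁻²)` and summable (`ae_tendsto_zero_of_normLe`). The key bound is a fourth moment
inequality for martingale differences (`NormLe.sum_range`), applied along rows and then across rows.

Finally, `g = d = m = 0` determines `θ` up to a simultaneous sign change of `β` and `b`
(`eq_or_eq_neg_of_contrast_eq_zero`). The changed point is excluded from `H`, and compactness turns
convergence of `contrast` into convergence of the estimator. -/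

noncomputable section

namespace HJM

/-! ### Independent Gaussian arrays and their σ-algebras. -/

section

variable {Ω : Type*}

/-- `ξ i j`, `i, j ≥ 0`, are independent standard normal random variables. -/
structure IsGaussianArray [MeasurableSpace Ω] (P : Measure Ω) (ξ : ℕ → ℕ → Ω → ℝ) : Prop where
  measurable : ∀ i j, Measurable (ξ i j)
  law : ∀ i j, P.map (ξ i j) = gaussianReal 0 1
  indep : iIndepFun (fun p : ℕ × ℕ => ξ p.1 p.2) P

/-- The σ-algebra generated by the entries of the array `ξ` with indices in `S`. -/
abbrev sigmaOn (ξ : ℕ → ℕ → Ω → ℝ) (S : Set (ℕ × ℕ)) : MeasurableSpace Ω :=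
  ⨆ p ∈ S, MeasurableSpace.comap (ξ p.1 p.2) inferInstance

lemma measurable_sigmaOn {ξ : ℕ → ℕ → Ω → ℝ} {S : Set (ℕ × ℕ)} {i j : ℕ} (h : (i, j) ∈ S) :
    Measurable[sigmaOn ξ S] (ξ i j) := by
  rw [measurable_iff_comap_le]
  exact le_iSup₂_of_le (f := fun (p : ℕ × ℕ) (_ : p ∈ S) =>
    MeasurableSpace.comap (ξ p.1 p.2) inferInstance) (i, j) h le_rfl

lemma sigmaOn_mono {ξ : ℕ → ℕ → Ω → ℝ} {S T : Set (ℕ × ℕ)} (h : S ⊆ T) :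
    sigmaOn ξ S ≤ sigmaOn ξ T :=
  biSup_mono fun _ hp => h hp

/-- The noise starts at time 1 and the array at row 0, hence the shift; the past up to time `k`
becomes the rows below `k`. -/
lemma pastSigma_eq_sigmaOn (η : ℕ → ℕ → Ω → ℝ) (k : ℕ) :
    pastSigma η k = sigmaOn (fun i j => η (i + 1) j) {p | p.1 < k} := by
  apply le_antisymm
  · refine iSup₂_le fun i hi => iSup_le fun j => ?_
    rw [Finset.mem_Icc] at hi
    obtain ⟨i, rfl⟩ := Nat.exists_eq_add_of_le' hi.1
    exact le_iSup₂_of_le (f := fun (p : ℕ × ℕ) (_ : p ∈ {p : ℕ × ℕ | p.1 < k}) =>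
      MeasurableSpace.comap (η (p.1 + 1) p.2) inferInstance) (i, j)
      (by simp; omega) le_rfl
  · refine iSup₂_le fun p hp => ?_
    simp only [Set.mem_ofPred_eq] at hp
    exact le_iSup₂_of_le (f := fun (i : ℕ) (_ : i ∈ Finset.Icc 1 k) =>
      ⨆ j : ℕ, MeasurableSpace.comap (η i j) inferInstance) (p.1 + 1)
      (by simp; omega) (le_iSup (fun j => MeasurableSpace.comap (η (p.1 + 1) j) inferInstance) p.2)

variable [MeasurableSpace Ω] {P : Measure Ω} {ξ : ℕ → ℕ → Ω → ℝ}

lemma IsStandardNormalNoise.isGaussianArray {η : ℕ → ℕ → Ω → ℝ}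
    (h : IsStandardNormalNoise P η) : IsGaussianArray P fun i j => η (i + 1) j where
  measurable i j := h.measurable _ _ (by omega)
  law i j := h.law _ _ (by omega)
  indep := by
    have hinj : Function.Injective (fun p : ℕ × ℕ => ((⟨p.1 + 1, by omega⟩ : ℕ+), p.2)) := by
      rintro ⟨a, b⟩ ⟨c, d⟩ h
      simp only [Prod.mk.injEq] at h
      have h1 := congrArg PNat.val h.1
      simp only [PNat.mk_coe] at h1
      ext <;> simp <;> omega
    exact h.indep.precomp hinj

namespace IsGaussianArray

lemma sigmaOn_le (h : IsGaussianArray P ξ) (S : Set (ℕ × ℕ)) : sigmaOn ξ S ≤ ‹MeasurableSpace Ω› :=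
  iSup₂_le fun p _ => (h.measurable p.1 p.2).comap_le

lemma indep_sigmaOn (h : IsGaussianArray P ξ) {S T : Set (ℕ × ℕ)} (hST : Disjoint S T) :
    Indep (sigmaOn ξ S) (sigmaOn ξ T) P :=
  indep_iSup_of_disjoint
    (m := fun p : ℕ × ℕ => MeasurableSpace.comap (ξ p.1 p.2) inferInstance)
    (fun p => (h.measurable p.1 p.2).comap_le) h.indep hST

lemma indepFun (h : IsGaussianArray P ξ) {S T : Set (ℕ × ℕ)} (hST : Disjoint S T) {X Y : Ω → ℝ}
    (hX : Measurable[sigmaOn ξ S] X) (hY : Measurable[sigmaOn ξ T] Y) : IndepFun X Y P := by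
  rw [IndepFun_iff_Indep]
  exact indep_of_indep_of_le_left (indep_of_indep_of_le_right (h.indep_sigmaOn hST)
    (measurable_iff_comap_le.1 hY)) (measurable_iff_comap_le.1 hX)

/-- The product formula for independent variables needs measurability only, so the lemma applies to
cubes of sums times a factor without any moment estimate. -/
lemma integral_mul_eq_zero (h : IsGaussianArray P ξ) {S T : Set (ℕ × ℕ)} (hST : Disjoint S T)
    {X Y : Ω → ℝ} (hX : Measurable[sigmaOn ξ S] X) (hY : Measurable[sigmaOn ξ T] Y)
    (hY0 : ∫ ω, Y ω ∂P = 0) : ∫ ω, X ω * Y ω ∂P = 0 := by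
  have := (h.indepFun hST hX hY).integral_mul_eq_mul_integral
    (hX.mono (h.sigmaOn_le _) le_rfl).aestronglyMeasurable
    (hY.mono (h.sigmaOn_le _) le_rfl).aestronglyMeasurable
  rw [hY0, mul_zero] at this
  exact this

/-- A linear functional of a standard normal array is centred normal. -/
lemma map_sum (h : IsGaussianArray P ξ) (s : Finset (ℕ × ℕ)) (a : ℕ × ℕ → ℝ) :
    P.map (fun ω => ∑ p ∈ s, a p * ξ p.1 p.2 ω) =
      gaussianReal 0 (∑ p ∈ s, a p ^ 2).toNNReal := by
  classical
  have := h.indep.isProbabilityMeasure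
  induction s using Finset.induction_on with
  | empty => simp [Measure.map_const]
  | insert p s hp ih =>
    have h1 : P.map (fun ω => a p * ξ p.1 p.2 ω) = gaussianReal 0 (a p ^ 2).toNNReal := by
      have := gaussianReal_map_const_mul (μ := 0) (v := 1) (a p)
      rw [← h.law p.1 p.2, Measure.map_map (by fun_prop) (h.measurable _ _)] at this
      rw [Real.toNNReal_of_nonneg (sq_nonneg _)]
      simpa [Function.comp_def] using this
    have hm : ∀ S : Set (ℕ × ℕ), ∀ p ∈ S, Measurable[sigmaOn ξ S] fun ω => a p * ξ p.1 p.2 ω :=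
      fun S p hp => (measurable_sigmaOn hp).const_mul _
    have hind : IndepFun (fun ω => a p * ξ p.1 p.2 ω) (fun ω => ∑ p ∈ s, a p * ξ p.1 p.2 ω) P :=
      h.indepFun (S := {p}) (T := s) (by simpa using hp) (hm _ _ rfl)
        (Finset.measurable_fun_sum _ fun q hq => hm _ _ hq)
    have := gaussianReal_add_gaussianReal_of_indepFun hind h1 ih
    simp only [Finset.sum_insert hp]
    rw [Real.toNNReal_add (sq_nonneg _) (Finset.sum_nonneg fun _ _ => sq_nonneg _)]
    simpa [Pi.add_def] using this

lemma map_row_sum (h : IsGaussianArray P ξ) (k N : ℕ) (a : ℕ → ℝ) :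
    P.map (fun ω => ∑ i ∈ Finset.range N, a i * ξ k i ω) =
      gaussianReal 0 (∑ i ∈ Finset.range N, a i ^ 2).toNNReal := by
  have := h.map_sum ({k} ×ˢ Finset.range N) (fun p => a p.2)
  simpa [Finset.sum_product] using this

lemma integrable_exp_row_sum (h : IsGaussianArray P ξ) (k N : ℕ) (a : ℕ → ℝ) :
    Integrable (fun ω => Real.exp (∑ i ∈ Finset.range N, a i * ξ k i ω)) P := by
  have h1 := integrable_exp_mul_gaussianReal (μ := 0)
    (v := (∑ i ∈ Finset.range N, a i ^ 2).toNNReal) 1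
  rw [← h.map_row_sum k N a] at h1
  have h2 := h1.comp_measurable (Finset.measurable_fun_sum _ fun i _ => (h.measurable k i).const_mul _)
  simpa [Function.comp_def] using h2

lemma integral_exp_row_sum (h : IsGaussianArray P ξ) (k N : ℕ) (a : ℕ → ℝ) :
    ∫ ω, Real.exp (∑ i ∈ Finset.range N, a i * ξ k i ω) ∂P =
      Real.exp (1 / 2 * ∑ i ∈ Finset.range N, a i ^ 2) := by
  have := mgf_gaussianReal (h.map_row_sum k N a) 1
  rw [Real.coe_toNNReal _ (Finset.sum_nonneg fun _ _ => sq_nonneg _)] at this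
  simp only [mgf, one_mul, zero_add, one_pow, mul_one] at this
  rw [this]; ring_nf

end IsGaussianArray

end

/-! ### Autoregression, geometric sums and the drift identity. -/

/-- The solution of the first order recursion `z (ℓ + 1) = ϱ z ℓ + x ℓ`, `z 0 = 0`. -/
def ar (ϱ : ℝ) (x : ℕ → ℝ) : ℕ → ℝ
  | 0 => 0
  | ℓ + 1 => ϱ * ar ϱ x ℓ + x ℓ

lemma ar_add (ϱ : ℝ) (x z : ℕ → ℝ) (ℓ : ℕ) :
    ar ϱ (fun i => x i + z i) ℓ = ar ϱ x ℓ + ar ϱ z ℓ := by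
  induction ℓ with
  | zero => simp [ar]
  | succ ℓ ih => simp only [ar, ih]; ring

lemma ar_const_mul (ϱ c : ℝ) (x : ℕ → ℝ) (ℓ : ℕ) :
    ar ϱ (fun i => c * x i) ℓ = c * ar ϱ x ℓ := by
  induction ℓ with
  | zero => simp [ar]
  | succ ℓ ih => simp only [ar, ih]; ring

lemma ar_eq_sum (ϱ : ℝ) (x : ℕ → ℝ) (ℓ : ℕ) :
    ar ϱ x (ℓ + 1) = ∑ i ∈ Finset.range (ℓ + 1), ϱ ^ (ℓ - i) * x i := by
  induction ℓ with
  | zero => simp [ar]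
  | succ ℓ ih =>
    rw [ar, ih, Finset.sum_range_succ _ (ℓ + 1), Finset.mul_sum]
    congr 1
    · refine Finset.sum_congr rfl fun i hi => ?_
      rw [Finset.mem_range] at hi
      rw [show ℓ + 1 - i = ℓ - i + 1 by omega, pow_succ]; ring
    · simp

/-- The weight of the `i`-th noise in the `j`-th value of the autoregression. -/
def lagWeight (ϱ : ℝ) (i j : ℕ) : ℝ := if i ≤ j then ϱ ^ (j - i) else 0

lemma ar_eq_sum_lagWeight (ϱ : ℝ) (x : ℕ → ℝ) {j N : ℕ} (h : j < N) :
    ar ϱ x (j + 1) = ∑ i ∈ Finset.range N, lagWeight ϱ i j * x i := by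
  rw [ar_eq_sum]
  have hs : Finset.range (j + 1) ⊆ Finset.range N := Finset.range_subset_range.2 h
  rw [← Finset.sum_subset hs fun i _ hi => ?_]
  · refine Finset.sum_congr rfl fun i hi => ?_
    rw [lagWeight, if_pos (by rw [Finset.mem_range] at hi; omega)]
  · rw [lagWeight, if_neg (by rw [Finset.mem_range] at hi; omega), zero_mul]

/-- The geometric sum `∑_{i<n} ϱ^i`. -/
def geomSum (ϱ : ℝ) (n : ℕ) : ℝ := ∑ i ∈ Finset.range n, ϱ ^ i

lemma geomSum_succ (ϱ : ℝ) (n : ℕ) : geomSum ϱ (n + 1) = geomSum ϱ n + ϱ ^ n :=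
  Finset.sum_range_succ _ _

lemma geomSum_succ' (ϱ : ℝ) (n : ℕ) : geomSum ϱ (n + 1) = 1 + ϱ * geomSum ϱ n := by
  simp only [geomSum, Finset.sum_range_succ' _ n, Finset.mul_sum, pow_succ]
  simp [mul_comm, add_comm]

/-- This exhibits the quadratic part of the innovation mean as the AR(1) input whose solution is the
square of a geometric sum; see `ar_geomSum`. It comes from splitting `2n + 1` terms into `n + 1` and
`n`. -/
lemma geomSum_two_mul_add_one (ϱ : ℝ) (n : ℕ) :
    geomSum ϱ (2 * n + 1) = geomSum ϱ (n + 1) ^ 2 - ϱ * geomSum ϱ n ^ 2 := by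
  have h1 : geomSum ϱ (2 * n + 1) = geomSum ϱ (n + 1) + ϱ ^ (n + 1) * geomSum ϱ n := by
    simp only [geomSum, Finset.mul_sum, ← pow_add]
    rw [show 2 * n + 1 = n + 1 + n by ring, Finset.sum_range_add]
  rw [h1, sq (geomSum ϱ (n + 1))]
  nth_rw 3 [geomSum_succ']
  have h2 := geomSum_succ ϱ n
  rw [h2, pow_succ]; ring

/-- The coefficient of the `ℓ`-th noise in the exponent of the risk factor. -/
def riskCoeff {J : ℕ} (ϱ : ℝ) (b : Fin (J + 1) → ℝ) (ℓ : ℕ) : ℝ :=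
  ∑ j : Fin (J + 1), if ℓ ≤ (j : ℕ) then b j * ϱ ^ ((j : ℕ) - ℓ) else 0

/-- The mean of the innovation `y k ℓ` in the model with parameters `θ`. -/
def innovationMean {J : ℕ} (θ : Param J) (ℓ : ℕ) : ℝ :=
  θ.1 ^ 2 / 2 * geomSum θ.2.1 (2 * ℓ + 1) - θ.1 * riskCoeff θ.2.1 θ.2.2 ℓ

lemma ar_geomSum (ϱ : ℝ) (ℓ : ℕ) :
    ar ϱ (fun i => geomSum ϱ (2 * i + 1)) ℓ = geomSum ϱ ℓ ^ 2 := by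
  induction ℓ with
  | zero => simp [ar, geomSum]
  | succ ℓ ih => rw [ar, ih, geomSum_two_mul_add_one]; ring

lemma ar_innovationMean {J : ℕ} (θ : Param J) (ℓ : ℕ) :
    ar θ.2.1 (innovationMean θ) ℓ =
      θ.1 ^ 2 / 2 * geomSum θ.2.1 ℓ ^ 2 - θ.1 * ar θ.2.1 (riskCoeff θ.2.1 θ.2.2) ℓ := by
  rw [← ar_geomSum, ← ar_const_mul, sub_eq_add_neg, ← neg_mul, ← ar_const_mul, ← ar_add]
  congr 1; ext i; simp only [innovationMean]; ring

/-- `∑_{j<m} lagWeight ϱ i j`. -/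
def lagSum (ϱ : ℝ) (m i : ℕ) : ℝ := ∑ j ∈ Finset.range m, lagWeight ϱ i j

lemma lagSum_eq_geomSum (ϱ : ℝ) {i m : ℕ} (h : i ≤ m) : lagSum ϱ m i = geomSum ϱ (m - i) := by
  induction m, h using Nat.le_induction with
  | base =>
    rw [Nat.sub_self, lagSum, geomSum, Finset.range_zero, Finset.sum_empty]
    exact Finset.sum_eq_zero fun j hj => by
      rw [lagWeight, if_neg (by rw [Finset.mem_range] at hj; omega)]
  | succ m h ih =>
    rw [show m + 1 - i = m - i + 1 by omega, geomSum_succ, ← ih, lagSum, lagSum,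
      Finset.sum_range_succ, lagWeight, if_pos h]

/-- The logarithm of the mean of `exp (∑_j b_j Δ₁ S k j - β ∑_{j<m} Δ₁ S k j)`. -/
def logMean {J : ℕ} (θ : Param J) (N m : ℕ) : ℝ :=
  1 / 2 * ∑ i ∈ Finset.range N, (riskCoeff θ.2.1 θ.2.2 i - θ.1 * lagSum θ.2.1 m i) ^ 2

/-- Telescoping: each summand is half of `geomSum ϱ (r + 1) ^ 2 - geomSum ϱ r ^ 2`. -/
lemma sum_range_geomSum (ϱ : ℝ) (m : ℕ) :
    ∑ r ∈ Finset.range m, (ϱ ^ r * geomSum ϱ r + (ϱ ^ r) ^ 2 / 2) = geomSum ϱ m ^ 2 / 2 := by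
  induction m with
  | zero => simp [geomSum]
  | succ m ih => rw [Finset.sum_range_succ, ih, geomSum_succ]; ring

/-- The discrete HJM drift condition. Lengthening the maturity by one adds `lagWeight ϱ i m` to the
exposure to noise `i`, which is zero for `i > m`. The difference of squares is a square of
volatilities minus a covariance with the risk factor, and both parts solve the AR(1) recursion. -/
lemma logMean_succ_sub {J : ℕ} (θ : Param J) {N m : ℕ} (h : m < N) :
    logMean θ N (m + 1) - logMean θ N m = ar θ.2.1 (innovationMean θ) (m + 1) := by
  rw [ar_innovationMean]
  obtain ⟨β, ϱ, b⟩ := θ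
  simp only [logMean]
  have h1 : ∀ i, lagSum ϱ (m + 1) i = lagSum ϱ m i + lagWeight ϱ i m := fun i => by
    simp [lagSum, Finset.sum_range_succ]
  rw [← mul_sub, ← Finset.sum_sub_distrib, ← Finset.sum_subset (Finset.range_subset_range.2 h)
    fun i _ hi => ?_]
  swap
  · rw [h1, lagWeight, if_neg (by rw [Finset.mem_range] at hi; omega)]; ring
  have h2 : ∀ i ∈ Finset.range (m + 1),
      (riskCoeff ϱ b i - β * lagSum ϱ (m + 1) i) ^ 2 - (riskCoeff ϱ b i - β * lagSum ϱ m i) ^ 2 =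
      2 * β ^ 2 * (ϱ ^ (m - i) * geomSum ϱ (m - i) + (ϱ ^ (m - i)) ^ 2 / 2)
        - 2 * β * (ϱ ^ (m - i) * riskCoeff ϱ b i) := fun i hi => by
    rw [Finset.mem_range, Nat.lt_succ_iff] at hi
    rw [h1, lagSum_eq_geomSum _ hi, lagWeight, if_pos hi]; ring
  rw [Finset.sum_congr rfl h2, Finset.sum_sub_distrib, ← Finset.mul_sum, ← Finset.mul_sum,
    ar_eq_sum]
  have h3 := Finset.sum_range_reflect
    (fun r => ϱ ^ r * geomSum ϱ r + (ϱ ^ r) ^ 2 / 2) (m + 1)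
  simp only [Nat.add_sub_cancel] at h3
  rw [sum_range_geomSum] at h3
  rw [h3]; ring

/-! ### Consequences of the no-arbitrage condition. -/

section

variable {Ω : Type*}

lemma fieldIncr_eq_ar (ϱ : ℝ) (η : ℕ → ℕ → Ω → ℝ) (k ℓ : ℕ) (ω : Ω) :
    fieldIncr ϱ η k ℓ ω = ar ϱ (fun i => η (k + 1) i ω) (ℓ + 1) := by
  induction ℓ with
  | zero => simp [fieldIncr, field, ar]
  | succ ℓ ih =>
    rw [ar, ← ih]
    simp only [fieldIncr, field]
    ring

lemma sum_mul_fieldIncr {J : ℕ} (ϱ : ℝ) (b : Fin (J + 1) → ℝ) (η : ℕ → ℕ → Ω → ℝ) {k N : ℕ}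
    (hN : J < N) (ω : Ω) :
    ∑ j : Fin (J + 1), b j * fieldIncr ϱ η k j ω =
      ∑ i ∈ Finset.range N, riskCoeff ϱ b i * η (k + 1) i ω := by
  have : ∀ j : Fin (J + 1), b j * fieldIncr ϱ η k j ω =
      ∑ i ∈ Finset.range N, (if i ≤ (j : ℕ) then b j * ϱ ^ ((j : ℕ) - i) else 0) *
        η (k + 1) i ω := fun j => by
    rw [fieldIncr_eq_ar, ar_eq_sum_lagWeight _ _ (N := N) (by omega), Finset.mul_sum]
    refine Finset.sum_congr rfl fun i _ => ?_
    rw [lagWeight]; split_ifs <;> ring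
  rw [Finset.sum_congr rfl fun j _ => this j, Finset.sum_comm]
  exact Finset.sum_congr rfl fun i _ => by rw [riskCoeff, Finset.sum_mul]

lemma sum_range_fieldIncr (ϱ : ℝ) (η : ℕ → ℕ → Ω → ℝ) {k m N : ℕ} (hN : m ≤ N) (ω : Ω) :
    ∑ j ∈ Finset.range m, fieldIncr ϱ η k j ω =
      ∑ i ∈ Finset.range N, lagSum ϱ m i * η (k + 1) i ω := by
  rw [Finset.sum_congr rfl fun j hj => by
    rw [fieldIncr_eq_ar, ar_eq_sum_lagWeight _ _ (N := N)
      (by rw [Finset.mem_range] at hj; omega)], Finset.sum_comm]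
  exact Finset.sum_congr rfl fun i _ => by rw [lagSum, Finset.sum_mul]

lemma measurable_fieldIncr (ϱ : ℝ) (η : ℕ → ℕ → Ω → ℝ) (k ℓ : ℕ) :
    Measurable[pastSigma η (k + 1)] (fieldIncr ϱ η k ℓ) := by
  have : fieldIncr ϱ η k ℓ = fun ω => ∑ i ∈ Finset.range (ℓ + 1), ϱ ^ (ℓ - i) * η (k + 1) i ω := by
    ext ω; rw [fieldIncr_eq_ar, ar_eq_sum]
  rw [this, pastSigma_eq_sigmaOn]
  exact Finset.measurable_fun_sum _ fun i _ =>
    (measurable_sigmaOn (ξ := fun i j => η (i + 1) j) (i := k) (j := i) (by simp)).const_mul _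

lemma pastSigma_mono (η : ℕ → ℕ → Ω → ℝ) {i k : ℕ} (h : i ≤ k) :
    pastSigma η i ≤ pastSigma η k := by
  rw [pastSigma_eq_sigmaOn, pastSigma_eq_sigmaOn]
  exact sigmaOn_mono fun p hp => lt_of_lt_of_le hp h

lemma measurable_forwardRate {β ϱ : ℝ} {f₀ : ℕ → ℝ} {α η : ℕ → ℕ → Ω → ℝ}
    (hα : ∀ k ℓ, Measurable[pastSigma η k] (α k ℓ)) (k ℓ : ℕ) :
    Measurable[pastSigma η k] (forwardRate β ϱ f₀ α η k ℓ) := by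
  induction k with
  | zero => exact measurable_const
  | succ k ih =>
    have hle := pastSigma_mono η (Nat.le_succ k)
    exact ((ih.mono hle le_rfl).add ((hα k ℓ).mono hle le_rfl)).add
      ((measurable_fieldIncr ϱ η k ℓ).const_mul β)

lemma measurable_riskFactor {J : ℕ} (ϱ : ℝ) (b : Fin (J + 1) → ℝ) (η : ℕ → ℕ → Ω → ℝ) (k : ℕ) :
    Measurable[pastSigma η (k + 1)] (riskFactor ϱ b η k) :=
  Real.measurable_exp.comp (Finset.measurable_fun_sum _ fun j _ =>
    (measurable_fieldIncr ϱ η k j).const_mul _)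

variable [MeasurableSpace Ω] {P : Measure Ω}

lemma measurable_discountFactor {J : ℕ} {ϱ : ℝ} {b : Fin (J + 1) → ℝ} {f η : ℕ → ℕ → Ω → ℝ}
    (hf : ∀ k ℓ, Measurable[pastSigma η k] (f k ℓ)) (k : ℕ) :
    Measurable[pastSigma η k] (discountFactor P ϱ b f η k) := by
  induction k with
  | zero => exact measurable_const
  | succ k ih =>
    have hle := pastSigma_mono η (Nat.le_succ k)
    exact ((ih.mono hle le_rfl).mul (((Real.measurable_exp.comp (hf k 0).neg)).mono hle le_rfl)).mul
      ((measurable_riskFactor ϱ b η k).div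
        (stronglyMeasurable_condExp.measurable.mono hle le_rfl))

/-- Functions of the noise at time `k + 1` are independent of the past up to time `k`. -/
lemma condExp_exp_row_sum {η : ℕ → ℕ → Ω → ℝ} (hη : IsStandardNormalNoise P η)
    (k N : ℕ) (a : ℕ → ℝ) :
    P[fun ω => Real.exp (∑ i ∈ Finset.range N, a i * η (k + 1) i ω) | pastSigma η k] =ᵐ[P]
      fun _ => Real.exp (1 / 2 * ∑ i ∈ Finset.range N, a i ^ 2) := by
  have hξ := hη.isGaussianArray
  have := hξ.indep.isProbabilityMeasure
  have hm : Measurable[sigmaOn (fun i j => η (i + 1) j) {p | p.1 = k}]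
      fun ω => Real.exp (∑ i ∈ Finset.range N, a i * η (k + 1) i ω) :=
    Real.measurable_exp.comp (Finset.measurable_fun_sum _ fun i _ =>
      (measurable_sigmaOn (ξ := fun i j => η (i + 1) j) (i := k) (j := i) (by simp)).const_mul _)
  rw [pastSigma_eq_sigmaOn]
  have h1 := condExp_indep_eq (hξ.sigmaOn_le {p | p.1 = k}) (hξ.sigmaOn_le {p | p.1 < k})
    hm.stronglyMeasurable (hξ.indep_sigmaOn (Set.disjoint_left.2 fun p h1 h2 => by
      simp only [Set.mem_ofPred_eq] at h1 h2; omega))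
  rwa [hξ.integral_exp_row_sum k N a] at h1

lemma condExp_riskFactor {J : ℕ} {η : ℕ → ℕ → Ω → ℝ} (hη : IsStandardNormalNoise P η)
    (ϱ : ℝ) (b : Fin (J + 1) → ℝ) (k : ℕ) {N : ℕ} (hN : J < N) :
    P[riskFactor ϱ b η k | pastSigma η k] =ᵐ[P]
      fun _ => Real.exp (1 / 2 * ∑ i ∈ Finset.range N, riskCoeff ϱ b i ^ 2) := by
  have h1 : riskFactor ϱ b η k =
      fun ω => Real.exp (∑ i ∈ Finset.range N, riskCoeff ϱ b i * η (k + 1) i ω) := by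
    ext ω; rw [riskFactor, sum_mul_fieldIncr _ _ _ hN]
  rw [h1]
  exact condExp_exp_row_sum hη k N _

lemma discountFactor_pos {J : ℕ} {ϱ : ℝ} {b : Fin (J + 1) → ℝ} {f η : ℕ → ℕ → Ω → ℝ}
    (hη : IsStandardNormalNoise P η) (k : ℕ) :
    ∀ᵐ ω ∂P, 0 < discountFactor P ϱ b f η k ω := by
  induction k with
  | zero => exact .of_forall fun _ => one_pos
  | succ k ih =>
    filter_upwards [ih, condExp_riskFactor hη ϱ b k (Nat.lt_succ_self J)] with ω h1 h2
    simp only [discountFactor, h2]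
    exact mul_pos (mul_pos h1 (Real.exp_pos _)) (div_pos (Real.exp_pos _) (Real.exp_pos _))

/-- The no-arbitrage condition determines the partial sums of the drift. -/
lemma IsModel.sum_drift {J : ℕ} {θ : Param J} {f₀ : ℕ → ℝ} {α η f : ℕ → ℕ → Ω → ℝ}
    (hf : IsModel P θ f₀ α η f) (k m : ℕ) {N : ℕ} (hJ : J < N) (hm : m ≤ N) :
    ∀ᵐ ω ∂P, f k 0 ω + ∑ j ∈ Finset.range m, (f k j ω + α k j ω)
      - ∑ j ∈ Finset.range (m + 1), f k j ω = logMean θ N m - logMean θ N 0 := by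
  have hη := hf.noise
  have hξ := hη.isGaussianArray
  have hP := hξ.indep.isProbabilityMeasure
  have hfm : ∀ k ℓ, Measurable[pastSigma η k] (f k ℓ) := fun k ℓ => by
    rw [hf.dynamics]; exact measurable_forwardRate hf.drift k ℓ
  obtain ⟨β, ϱ, b⟩ := θ
  have hle : pastSigma η k ≤ ‹MeasurableSpace Ω› := by
    rw [pastSigma_eq_sigmaOn]; exact hξ.sigmaOn_le _
  -- With this maturity the bond price at time `k + 1` contains `m` forward rates and the one at
  -- time `k` contains `m + 1`.
  obtain ⟨hint, hmart⟩ := hf.noArbitrage (k + 1 + m) (by omega)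
  have hmart := hmart k (k + 1) (by omega) (by omega)
  have hint := hint (k + 1) (by omega)
  set M := discountFactor P ϱ b f η with hM
  set a : ℕ → ℝ := fun i => riskCoeff ϱ b i - β * lagSum ϱ m i with ha
  set c := Real.exp (1 / 2 * ∑ i ∈ Finset.range N, riskCoeff ϱ b i ^ 2) with hc
  -- The discounted price at time `k + 1` factors into `X`, known at time `k`, and `Y`, a function
  -- of the fresh noise row. Conditioning pulls out `X` and replaces `Y` by its mean.
  set X : Ω → ℝ := fun ω => M k ω * Real.exp (-f k 0 ω) / c *
    Real.exp (-∑ j ∈ Finset.range m, (f k j ω + α k j ω)) with hX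
  set Y : Ω → ℝ := fun ω => Real.exp (∑ i ∈ Finset.range N, a i * η (k + 1) i ω) with hY
  have hXm : StronglyMeasurable[pastSigma η k] X := by
    refine Measurable.stronglyMeasurable ?_
    refine Measurable.mul (Measurable.div_const (Measurable.mul
      (measurable_discountFactor hfm k) (Real.measurable_exp.comp (hfm k 0).neg)) _)
      (Real.measurable_exp.comp (Measurable.neg ?_))
    exact Finset.measurable_fun_sum _ fun j _ => (hfm k j).add (hf.drift k j)
  have hXY : (fun ω => M (k + 1) ω * bondPrice f (k + 1) (k + 1 + m) ω) =ᵐ[P] X * Y := by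
    filter_upwards [condExp_riskFactor hη ϱ b k hJ] with ω h1
    have h2 : ∑ j ∈ Finset.range m, f (k + 1) j ω =
        ∑ j ∈ Finset.range m, (f k j ω + α k j ω) +
          β * ∑ i ∈ Finset.range N, lagSum ϱ m i * η (k + 1) i ω := by
      rw [← sum_range_fieldIncr _ _ hm, Finset.mul_sum, ← Finset.sum_add_distrib]
      refine Finset.sum_congr rfl fun j _ => ?_
      rw [hf.dynamics]; rfl
    have h3 : ∑ i ∈ Finset.range N, a i * η (k + 1) i ω =
        ∑ i ∈ Finset.range N, riskCoeff ϱ b i * η (k + 1) i ω -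
          β * ∑ i ∈ Finset.range N, lagSum ϱ m i * η (k + 1) i ω := by
      rw [Finset.mul_sum, ← Finset.sum_sub_distrib]
      exact Finset.sum_congr rfl fun i _ => by simp only [ha]; ring
    simp only [Pi.mul_apply, hX, hY, h3, bondPrice, hM, discountFactor, h1]
    rw [Nat.add_sub_cancel_left, h2, riskFactor, sum_mul_fieldIncr _ _ _ hJ, neg_add,
      Real.exp_add, sub_eq_add_neg, Real.exp_add]
    ring
  have hYint : Integrable Y P := hξ.integrable_exp_row_sum k N a
  have hpull := condExp_mul_of_stronglyMeasurable_left (μ := P) hXm (hint.congr hXY) hYint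
  filter_upwards [hmart, condExp_congr_ae (m := pastSigma η k) hXY, hpull,
    condExp_exp_row_sum hη k N a, discountFactor_pos (ϱ := ϱ) (b := b) (f := f) hη k]
    with ω h1 h2 h3 h4 h5
  rw [h2, h3, Pi.mul_apply, h4] at h1
  simp only [hX, bondPrice] at h1
  rw [show k + 1 + m - k = m + 1 by omega] at h1
  have h6 : Real.exp (-f k 0 ω - (1 / 2 * ∑ i ∈ Finset.range N, riskCoeff ϱ b i ^ 2) +
      (-∑ j ∈ Finset.range m, (f k j ω + α k j ω)) + 1 / 2 * ∑ i ∈ Finset.range N, a i ^ 2) =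
      Real.exp (-∑ j ∈ Finset.range (m + 1), f k j ω) := by
    apply mul_left_cancel₀ h5.ne'
    rw [← h1, Real.exp_add, Real.exp_add, Real.exp_sub]
    ring
  have h7 := Real.exp_injective h6
  simp only [logMean, lagSum, Finset.range_zero, Finset.sum_empty, mul_zero, sub_zero]
  simp only [ha, lagSum] at h7
  linarith

/-- The innovations of the forward rates along maturity dates, under no arbitrage. -/
theorem IsModel.forward_increment {J : ℕ} {θ : Param J} {f₀ : ℕ → ℝ} {α η f : ℕ → ℕ → Ω → ℝ}
    (hf : IsModel P θ f₀ α η f) :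
    ∀ᵐ ω ∂P, ∀ k ℓ, f (k + 1) ℓ ω - f k (ℓ + 1) ω =
      ar θ.2.1 (fun i => innovationMean θ i + θ.1 * η (k + 1) i ω) (ℓ + 1) := by
  rw [ae_all_iff]; intro k
  rw [ae_all_iff]; intro ℓ
  -- Subtracting the identities for `ℓ` and `ℓ + 1` isolates a single drift. Both use the same
  -- truncation level, large enough for the risk factor and for the longer sum.
  filter_upwards [hf.sum_drift k ℓ (N := J + ℓ + 1) (by omega) (by omega),
    hf.sum_drift k (ℓ + 1) (N := J + ℓ + 1) (by omega) (by omega)] with ω h1 h2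
  rw [ar_add, ar_const_mul, ← fieldIncr_eq_ar, ← logMean_succ_sub θ (N := J + ℓ + 1) (by omega)]
  rw [Finset.sum_range_succ, Finset.sum_range_succ _ (ℓ + 1)] at h2
  have h3 : f (k + 1) ℓ ω = f k ℓ ω + α k ℓ ω + θ.1 * fieldIncr θ.2.1 η k ℓ ω := by
    rw [hf.dynamics]; rfl
  rw [h3]
  linarith

end

/-! ### The likelihood as a quadratic form in the noise. -/

lemma sum_Icc_one_eq_sum_range (g : ℕ → ℝ) (K : ℕ) :
    ∑ k ∈ Finset.Icc 1 K, g k = ∑ k ∈ Finset.range K, g (k + 1) := by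
  rw [Finset.range_eq_Ico, Finset.sum_Ico_add' g 0 K 1]
  rfl

/-- The sum of the array `a` over the antidiagonal with endpoints `(0, k + L)` and `(k, L)`. -/
def diagSum (a : ℕ → ℕ → ℝ) (L k : ℕ) : ℝ := ∑ j ∈ Finset.range (k + 1), a j (k + L - j)

/-- The inner product of arrays which represents the quadratic form of the likelihood. -/
def pairing (K L : ℕ) (a b : ℕ → ℕ → ℝ) : ℝ :=
  ∑ k ∈ Finset.range K, ∑ ℓ ∈ Finset.range L, a k ℓ * b k ℓ +
    ∑ k ∈ Finset.range K, 1 / ((k : ℝ) + 1) * (diagSum a L k * diagSum b L k)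

lemma diagSum_add (a b : ℕ → ℕ → ℝ) (L k : ℕ) :
    diagSum (fun i j => a i j + b i j) L k = diagSum a L k + diagSum b L k :=
  Finset.sum_add_distrib

lemma diagSum_const_mul (c : ℝ) (a : ℕ → ℕ → ℝ) (L k : ℕ) :
    diagSum (fun i j => c * a i j) L k = c * diagSum a L k :=
  (Finset.mul_sum _ _ _).symm

lemma pairing_comm (K L : ℕ) (a b : ℕ → ℕ → ℝ) : pairing K L a b = pairing K L b a := by
  simp only [pairing, mul_comm (a _ _), mul_comm (diagSum a _ _)]

lemma pairing_add_right (K L : ℕ) (a b c : ℕ → ℕ → ℝ) :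
    pairing K L a (fun i j => b i j + c i j) = pairing K L a b + pairing K L a c := by
  simp only [pairing, diagSum_add, mul_add, Finset.sum_add_distrib]; ring

lemma pairing_const_mul_right (K L : ℕ) (t : ℝ) (a b : ℕ → ℕ → ℝ) :
    pairing K L a (fun i j => t * b i j) = t * pairing K L a b := by
  simp only [pairing, diagSum_const_mul, mul_left_comm _ t, ← Finset.mul_sum, mul_add]

lemma pairing_sq_add (K L : ℕ) (t : ℝ) (a b : ℕ → ℕ → ℝ) :
    pairing K L (fun i j => t * a i j + b i j) (fun i j => t * a i j + b i j) =
      t ^ 2 * pairing K L a a + 2 * t * pairing K L a b + pairing K L b b := by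
  rw [pairing_add_right, pairing_const_mul_right, pairing_comm K L _ a, pairing_comm K L _ b,
    pairing_add_right, pairing_add_right, pairing_const_mul_right, pairing_const_mul_right,
    pairing_comm K L b a]
  ring

/-- The deterministic part of the difference between the innovations computed with the parameters
`θ` and those computed with the true parameters `θ₀`. -/
def meanGap {J : ℕ} (θ₀ θ : Param J) (ℓ : ℕ) : ℝ :=
  innovationMean θ₀ ℓ - innovationMean θ ℓ
    - (θ.2.1 - θ₀.2.1) * ar θ₀.2.1 (innovationMean θ₀) ℓ

/-- The difference between the innovations computed with the parameters `θ` and those computed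
with the true parameters `θ₀`, for the noise `ξ`. -/
def gap {J : ℕ} (θ₀ θ : Param J) (ξ : ℕ → ℕ → ℝ) (k ℓ : ℕ) : ℝ :=
  meanGap θ₀ θ ℓ - (θ.2.1 - θ₀.2.1) * θ₀.1 * ar θ₀.2.1 (ξ k) ℓ

lemma gap_self {J : ℕ} (θ₀ : Param J) (ξ : ℕ → ℕ → ℝ) (k ℓ : ℕ) : gap θ₀ θ₀ ξ k ℓ = 0 := by
  simp [gap, meanGap]

section

variable {J : ℕ} {θ₀ : Param J} {x ξ : ℕ → ℕ → ℝ}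

/-- Filtering with `ϱ` instead of `ϱ₀` changes the residual by `ϱ - ϱ₀` times the preceding
increment, which is itself an AR(1) value of the mean plus noise. This produces the `ar` terms in
`gap` and `meanGap`. -/
lemma y_sub_innovationMean
    (hx : ∀ k ℓ, x (k + 1) ℓ - x k (ℓ + 1) =
      ar θ₀.2.1 (fun i => innovationMean θ₀ i + θ₀.1 * ξ k i) (ℓ + 1)) (θ : Param J) (k ℓ : ℕ) :
    y x θ.2.1 (k + 1) ℓ - innovationMean θ ℓ = θ₀.1 * ξ k ℓ + gap θ₀ θ ξ k ℓ := by
  cases ℓ with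
  | zero =>
    have := hx k 0
    simp only [ar, mul_zero, zero_add] at this
    simp only [y, gap, meanGap, ar, Nat.add_sub_cancel]
    linarith
  | succ ℓ =>
    have h1 := hx k ℓ
    have h2 := hx k (ℓ + 1)
    rw [ar, ← h1] at h2
    rw [ar_add, ar_const_mul] at h1
    simp only [y, gap, meanGap, Nat.add_sub_cancel]
    linear_combination h2 - (θ.2.1 - θ₀.2.1) * h1

/-- The residuals telescope along the antidiagonal. Since `L > 0`, all its entries have positive
second index, so the special formula of `y` at `ℓ = 0` never occurs. -/
lemma yTilde_eq_diagSum (x : ℕ → ℕ → ℝ) (ϱ : ℝ) (k : ℕ) {L : ℕ} (hL : 0 < L) :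
    yTilde x ϱ (k + 1) L = diagSum (fun j ℓ => y x ϱ (j + 1) ℓ) L k := by
  obtain ⟨L, rfl⟩ := Nat.exists_eq_add_of_le' hL
  have h1 : ∀ j ∈ Finset.range (k + 1), y x ϱ (j + 1) (k + (L + 1) - j) =
      (x (j + 1) (k + 1 + (L + 1) - (j + 1)) - ϱ * x (j + 1) (k + (L + 1) - (j + 1))) -
        (x j (k + 1 + (L + 1) - j) - ϱ * x j (k + (L + 1) - j)) := fun j hj => by
    rw [Finset.mem_range] at hj
    obtain ⟨i, rfl⟩ := Nat.exists_eq_add_of_le (Nat.lt_succ_iff.1 hj)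
    rw [show j + i + (L + 1) - j = i + L + 1 by omega,
      show j + i + 1 + (L + 1) - (j + 1) = i + L + 1 by omega,
      show j + i + (L + 1) - (j + 1) = i + L by omega,
      show j + i + 1 + (L + 1) - j = i + L + 2 by omega]
    simp only [y, Nat.add_sub_cancel]
    ring
  rw [diagSum, Finset.sum_congr rfl h1, Finset.sum_range_sub
    (fun j => x j (k + 1 + (L + 1) - j) - ϱ * x j (k + (L + 1) - j))]
  rw [yTilde, show k + 1 + (L + 1) - (k + 1) = L + 1 by omega,
    show k + (L + 1) - (k + 1) = L by omega, show L + 1 - 1 = L by omega,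
    show k + 1 + (L + 1) - 1 = k + (L + 1) by omega]
  simp only [Nat.sub_zero]
  ring

/-- A further antidiagonal entry lowers the smallest exponent by one until it reaches zero; later
entries contribute nothing. So `q` collects the weights of `b j` in the risk coefficients along the
antidiagonal. -/
lemma q_eq_sum_add (ϱ : ℝ) (j k L : ℕ) :
    q ϱ j (k + 1) L =
      ∑ i ∈ Finset.range (k + 1), if L + i ≤ j then ϱ ^ (j - (L + i)) else 0 := by
  induction k with
  | zero =>
    simp only [q, Finset.sum_range_one, zero_add, add_zero]
    split_ifs with h
    · rw [show j + 1 - (1 + L) = j - L by omega]; simp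
    · rfl
  | succ k ih =>
    rw [Finset.sum_range_succ, ← ih]
    simp only [q]
    by_cases h3 : L + (k + 1) ≤ j
    · have h4 : Finset.Icc (j + 1 - (k + 1 + L)) (j - L) =
          Finset.Ioc (j - (L + (k + 1))) (j - L) := by
        ext n; simp only [Finset.mem_Icc, Finset.mem_Ioc]; omega
      rw [if_pos (by omega), if_pos (by omega), if_pos h3, h4,
        show j + 1 - (k + 1 + 1 + L) = j - (L + (k + 1)) by omega,
        ← Finset.add_sum_Ioc_eq_sum_Icc (by omega), add_comm]
    · rw [if_neg h3, add_zero, show j + 1 - (k + 1 + 1 + L) = j + 1 - (k + 1 + L) by omega]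

lemma q_eq_sum (ϱ : ℝ) (j k L : ℕ) :
    q ϱ j (k + 1) L =
      ∑ i ∈ Finset.range (k + 1), if k + L - i ≤ j then ϱ ^ (j - (k + L - i)) else 0 := by
  rw [q_eq_sum_add, ← Finset.sum_range_reflect]
  refine Finset.sum_congr rfl fun i hi => ?_
  rw [Finset.mem_range] at hi
  rw [show L + (k + 1 - 1 - i) = k + L - i by omega]

lemma diagSum_innovationMean (θ : Param J) (k L : ℕ) :
    diagSum (fun _ ℓ => innovationMean θ ℓ) L k =
      θ.1 ^ 2 / 2 * ∑ j ∈ Finset.Icc 1 (k + 1),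
        ∑ i ∈ Finset.range (2 * (k + 1 + L - j) + 1), θ.2.1 ^ i
        - θ.1 * ∑ j : Fin (J + 1), θ.2.2 j * q θ.2.1 j (k + 1) L := by
  rw [sum_Icc_one_eq_sum_range
    (fun j => ∑ i ∈ Finset.range (2 * (k + 1 + L - j) + 1), θ.2.1 ^ i)]
  simp only [diagSum, innovationMean, Finset.sum_sub_distrib, ← Finset.mul_sum, geomSum]
  congr 2
  · refine Finset.sum_congr rfl fun j _ => ?_
    rw [show k + 1 + L - (j + 1) = k + L - j by omega]
  · simp only [riskCoeff, q_eq_sum, Finset.mul_sum]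
    rw [Finset.sum_comm]
    simp only [mul_ite, mul_zero]

lemma logLikelihood_eq
    (hx : ∀ k ℓ, x (k + 1) ℓ - x k (ℓ + 1) =
      ar θ₀.2.1 (fun i => innovationMean θ₀ i + θ₀.1 * ξ k i) (ℓ + 1)) (θ : Param J)
    (K : ℕ) {L : ℕ} (hL : 0 < L) :
    logLikelihood K L x θ.1 θ.2.1 θ.2.2 =
      - ((K : ℝ) * ((L : ℝ) + 1) / 2) * Real.log (2 * Real.pi * θ.1 ^ 2)
      - 1 / 2 * Real.log (K.factorial : ℝ)
      - 1 / (2 * θ.1 ^ 2) * (θ₀.1 ^ 2 * pairing K L ξ ξ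
        + 2 * θ₀.1 * pairing K L ξ (gap θ₀ θ ξ) + pairing K L (gap θ₀ θ ξ) (gap θ₀ θ ξ)) := by
  rw [← pairing_sq_add, logLikelihood, sub_sub _ (1 / (2 * θ.1 ^ 2) * _), ← mul_add, pairing]
  congr 3
  · rw [sum_Icc_one_eq_sum_range (fun k => ∑ ℓ ∈ Finset.range L,
      (y x θ.2.1 k ℓ - θ.1 ^ 2 / 2 * ∑ i ∈ Finset.range (2 * ℓ + 1), θ.2.1 ^ i
        + θ.1 * ∑ j : Fin (J + 1),
          if ℓ ≤ (j : ℕ) then θ.2.2 j * θ.2.1 ^ ((j : ℕ) - ℓ) else 0) ^ 2)]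
    refine Finset.sum_congr rfl fun k _ => Finset.sum_congr rfl fun ℓ _ => ?_
    rw [← y_sub_innovationMean hx, innovationMean, riskCoeff, geomSum]
    ring
  · rw [sum_Icc_one_eq_sum_range (fun k => 1 / (k : ℝ) *
      (yTilde x θ.2.1 k L
        - θ.1 ^ 2 / 2 * ∑ j ∈ Finset.Icc 1 k, ∑ i ∈ Finset.range (2 * (k + L - j) + 1), θ.2.1 ^ i
        + θ.1 * ∑ j : Fin (J + 1), θ.2.2 j * q θ.2.1 j k L) ^ 2)]
    refine Finset.sum_congr rfl fun k _ => ?_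
    have h1 : (fun j ℓ => θ₀.1 * ξ j ℓ + gap θ₀ θ ξ j ℓ) =
        fun j ℓ => y x θ.2.1 (j + 1) ℓ + (-1) * innovationMean θ ℓ := by
      ext j ℓ; rw [← y_sub_innovationMean hx]; ring
    rw [h1, diagSum_add, diagSum_const_mul _ (fun _ ℓ => innovationMean θ ℓ),
      diagSum_innovationMean, ← yTilde_eq_diagSum _ _ _ hL]
    push_cast
    ring

/-- The basic inequality for a parameter whose likelihood is at least that of the true one. -/
theorem basic_inequality
    (hx : ∀ k ℓ, x (k + 1) ℓ - x k (ℓ + 1) =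
      ar θ₀.2.1 (fun i => innovationMean θ₀ i + θ₀.1 * ξ k i) (ℓ + 1)) {θ : Param J}
    (h0 : θ₀.1 ≠ 0) (h : θ.1 ≠ 0) {K L : ℕ} (hL : 0 < L)
    (hle : logLikelihood K L x θ₀.1 θ₀.2.1 θ₀.2.2 ≤ logLikelihood K L x θ.1 θ.2.1 θ.2.2) :
    (K : ℝ) * (L + 1) * ((θ.1 ^ 2 - θ₀.1 ^ 2) ^ 2 / (|θ.1| + |θ₀.1|) ^ 2)
      - (θ.1 ^ 2 - θ₀.1 ^ 2) * (pairing K L ξ ξ - K * (L + 1))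
      + 2 * θ₀.1 * pairing K L ξ (gap θ₀ θ ξ)
      + pairing K L (gap θ₀ θ ξ) (gap θ₀ θ ξ) ≤ 0 := by
  rw [logLikelihood_eq hx θ₀ K hL, logLikelihood_eq hx θ K hL] at hle
  have hgap : gap θ₀ θ₀ ξ = fun i j => 0 * ξ i j := by ext; simp [gap_self]
  have hz1 : pairing K L ξ (gap θ₀ θ₀ ξ) = 0 := by
    rw [hgap, pairing_const_mul_right, zero_mul]
  have hz2 : pairing K L (gap θ₀ θ₀ ξ) (gap θ₀ θ₀ ξ) = 0 := by
    nth_rw 2 [hgap]; rw [pairing_const_mul_right, zero_mul]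
  rw [hz1, hz2] at hle
  set T := pairing K L ξ ξ
  set A := pairing K L ξ (gap θ₀ θ ξ)
  set B := pairing K L (gap θ₀ θ ξ) (gap θ₀ θ ξ)
  set N : ℝ := (K : ℝ) * (L + 1) with hN
  have hNn : 0 ≤ N := by positivity
  have hb : 0 < |θ.1| := abs_pos.2 h
  have hb0 : 0 < |θ₀.1| := abs_pos.2 h0
  -- The sign of `β` need not agree with that of `β₀`, so the logarithm is compared in terms of
  -- absolute values.
  rw [← sq_abs θ.1, ← sq_abs θ₀.1] at hle ⊢
  set β := |θ.1|
  set β₀ := |θ₀.1|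
  have hlog : Real.log (2 * Real.pi * β₀ ^ 2) - Real.log (2 * Real.pi * β ^ 2) ≤
      2 * (β₀ / β - 1) := by
    have hpi := Real.pi_pos
    rw [Real.log_mul (mul_pos two_pos hpi).ne' (pow_pos hb 2).ne',
      Real.log_mul (mul_pos two_pos hpi).ne' (pow_pos hb0 2).ne', Real.log_pow, Real.log_pow]
    have := Real.log_le_sub_one_of_pos (div_pos hb0 hb)
    rw [Real.log_div hb0.ne' hb.ne'] at this
    push_cast
    linarith
  have e1 : (β ^ 2 - β₀ ^ 2) ^ 2 / (β + β₀) ^ 2 = (β - β₀) ^ 2 := by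
    field_simp; ring
  rw [e1]
  have h2 := mul_le_mul_of_nonneg_left hlog (mul_nonneg hNn (sq_nonneg β))
  have h3 := mul_le_mul_of_nonneg_left hle (show (0 : ℝ) ≤ 2 * β ^ 2 by positivity)
  have e2 : 2 * β ^ 2 * (1 / (2 * β ^ 2)) = 1 := by field_simp
  have e3 : 2 * β₀ ^ 2 * (1 / (2 * β₀ ^ 2)) = 1 := by field_simp
  -- After multiplication by `2 β²`, the logarithmic bound and the mean `N` of `pairing K L ξ ξ`
  -- combine to `N (β - β₀)²`.
  have e4 : β ^ 2 * (β₀ / β) = β * β₀ := by field_simp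
  have e5 : 2 * β ^ 2 * (1 / (2 * β₀ ^ 2)) * β₀ ^ 2 = β ^ 2 := by field_simp
  nlinarith [h2, h3, congrArg (· * (β₀ ^ 2 * T + 2 * θ₀.1 * A + B)) e2, congrArg (· * T) e5,
    congrArg (· * N) e4]

end

/-! ### Bounds that are uniform over the parameter set. -/

/-- The limit of `innovationMean θ ℓ` as `ℓ → ∞`. -/
def innovationLimit {J : ℕ} (θ : Param J) : ℝ := θ.1 ^ 2 / (2 * (1 - θ.2.1))

/-- The limit of `meanGap θ₀ θ ℓ` as `ℓ → ∞`. -/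
def gapLimit {J : ℕ} (θ₀ θ : Param J) : ℝ :=
  innovationLimit θ₀ - innovationLimit θ
    - (θ.2.1 - θ₀.2.1) * (innovationLimit θ₀ / (1 - θ₀.2.1))

/-- A parameter set on which all quantities of interest are uniformly bounded. -/
structure ParamBounds {J : ℕ} (H : Set (Param J)) (R r₀ r : ℝ) : Prop where
  one_le : 1 ≤ R
  nonneg : 0 ≤ r₀
  lt : r₀ < r
  lt_one : r < 1
  vol_ne : ∀ θ ∈ H, θ.1 ≠ 0
  vol_le : ∀ θ ∈ H, |θ.1| ≤ R
  coeff_le : ∀ θ ∈ H, ∀ j, |θ.2.2 j| ≤ R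
  auto_le : ∀ θ ∈ H, |θ.2.1| ≤ r₀

lemma exists_paramBounds {J : ℕ} {H : Set (Param J)} (hH : IsCompact H) (hne : H.Nonempty)
    (hβ : ∀ θ ∈ H, θ.1 ≠ 0) (hϱ : ∀ θ ∈ H, θ.2.1 ∈ Set.Ioo (-1 : ℝ) 1) :
    ∃ R r₀ r, ParamBounds H R r₀ r := by
  obtain ⟨R, hR⟩ := hH.isBounded.exists_norm_le
  obtain ⟨θ₁, h₁, hmax⟩ := hH.exists_isMaxOn hne
    (f := fun θ : Param J => |θ.2.1|) (by fun_prop)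
  have hlt : |θ₁.2.1| < 1 := abs_lt.2 (hϱ θ₁ h₁)
  -- The rate `r` is the midpoint between the largest `|ϱ|` and 1. A gap above `r₀` is needed
  -- because the AR(1) recursion is driven by inputs that themselves decay like `r ^ ℓ`.
  refine ⟨max R 1, |θ₁.2.1|, (1 + |θ₁.2.1|) / 2, le_max_right _ _, abs_nonneg _, by linarith,
    by linarith, hβ, fun θ hθ => ?_, fun θ hθ j => ?_, fun θ hθ => hmax hθ⟩
  · exact ((norm_fst_le θ).trans (hR θ hθ)).trans (le_max_left _ _)
  · exact ((norm_le_pi_norm θ.2.2 j).trans (((norm_snd_le θ.2).trans (norm_snd_le θ)).trans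
      (hR θ hθ))).trans (le_max_left _ _)

lemma geomSum_sub_inv {ϱ : ℝ} (h : ϱ ≠ 1) (n : ℕ) :
    geomSum ϱ n - 1 / (1 - ϱ) = -(ϱ ^ n / (1 - ϱ)) := by
  have h1 : 1 - ϱ ≠ 0 := sub_ne_zero.2 h.symm
  rw [geomSum, geom_sum_eq h]
  have h2 : ϱ - 1 ≠ 0 := sub_ne_zero.2 h
  field_simp
  ring

section

variable {J : ℕ} {H : Set (Param J)} {R r₀ r : ℝ}

lemma ParamBounds.one_sub_le (hH : ParamBounds H R r₀ r) {θ : Param J} (hθ : θ ∈ H) :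
    1 - r ≤ 1 - θ.2.1 := by
  have := (abs_le.1 (hH.auto_le θ hθ)).2
  have := hH.lt
  linarith

lemma ParamBounds.pos (hH : ParamBounds H R r₀ r) : 0 < r := hH.nonneg.trans_lt hH.lt

/-- Only `ℓ ≤ J` matters, and there `r ^ ℓ / r ^ J ≥ 1`, so a bounded quantity is trivially
dominated by a geometric one. -/
lemma ParamBounds.abs_riskCoeff_le (hH : ParamBounds H R r₀ r) {θ : Param J} (hθ : θ ∈ H) (ℓ : ℕ) :
    |riskCoeff θ.2.1 θ.2.2 ℓ| ≤ (J + 1) * (R / r ^ J) * r ^ ℓ := by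
  have hr := hH.pos
  have hR : 0 ≤ R := zero_le_one.trans hH.one_le
  rw [riskCoeff]
  refine (Finset.abs_sum_le_sum_abs _ _).trans ?_
  have : ∀ j ∈ (Finset.univ : Finset (Fin (J + 1))),
      |if ℓ ≤ (j : ℕ) then θ.2.2 j * θ.2.1 ^ ((j : ℕ) - ℓ) else 0| ≤ R / r ^ J * r ^ ℓ := by
    intro j _
    split_ifs with h
    · have h1 : |θ.2.1 ^ ((j : ℕ) - ℓ)| ≤ 1 := by
        rw [abs_pow]
        exact pow_le_one₀ (abs_nonneg _) ((hH.auto_le θ hθ).trans (hH.lt.trans hH.lt_one).le)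
      have h2 : r ^ J ≤ r ^ ℓ := pow_le_pow_of_le_one hr.le hH.lt_one.le (by omega)
      rw [abs_mul]
      calc |θ.2.2 j| * |θ.2.1 ^ ((j : ℕ) - ℓ)| ≤ R * 1 :=
            mul_le_mul (hH.coeff_le θ hθ j) h1 (abs_nonneg _) hR
        _ = R / r ^ J * r ^ J := by field_simp
        _ ≤ R / r ^ J * r ^ ℓ := by gcongr
    · rw [abs_zero]; positivity
  refine (Finset.sum_le_sum this).trans (le_of_eq ?_)
  simp; ring

lemma ParamBounds.exists_innovationMean_bound (hH : ParamBounds H R r₀ r) :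
    ∃ C, 0 ≤ C ∧ ∀ θ ∈ H, ∀ ℓ, |innovationMean θ ℓ - innovationLimit θ| ≤ C * r ^ ℓ := by
  have hr := hH.pos
  have hr1 : 0 < 1 - r := sub_pos.2 hH.lt_one
  have hR : 0 ≤ R := zero_le_one.trans hH.one_le
  refine ⟨R ^ 2 / 2 / (1 - r) + R * ((J + 1) * (R / r ^ J)), by positivity, fun θ hθ ℓ => ?_⟩
  have hϱ := hH.one_sub_le hθ
  have h1 : innovationMean θ ℓ - innovationLimit θ =
      θ.1 ^ 2 / 2 * (geomSum θ.2.1 (2 * ℓ + 1) - 1 / (1 - θ.2.1))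
        - θ.1 * riskCoeff θ.2.1 θ.2.2 ℓ := by
    rw [innovationMean, innovationLimit]
    have : 1 - θ.2.1 ≠ 0 := by linarith
    field_simp
    ring
  rw [h1, geomSum_sub_inv (by linarith)]
  refine (abs_sub _ _).trans ?_
  rw [add_mul]
  refine add_le_add ?_ ?_
  · rw [abs_mul, abs_neg, abs_div, abs_div, abs_pow, abs_pow, abs_two,
      abs_of_pos (by linarith : 0 < 1 - θ.2.1)]
    have h2 : |θ.2.1| ^ (2 * ℓ + 1) ≤ r ^ ℓ := by
      have h3 : |θ.2.1| ≤ r := (hH.auto_le θ hθ).trans hH.lt.le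
      calc |θ.2.1| ^ (2 * ℓ + 1) ≤ r ^ (2 * ℓ + 1) := by gcongr
        _ ≤ r ^ ℓ := pow_le_pow_of_le_one hr.le hH.lt_one.le (by omega)
    have h4 := hH.vol_le θ hθ
    have h5 : 0 < 1 - θ.2.1 := by linarith
    calc |θ.1| ^ 2 / 2 * (|θ.2.1| ^ (2 * ℓ + 1) / (1 - θ.2.1))
        ≤ R ^ 2 / 2 * (r ^ ℓ / (1 - r)) := by gcongr
      _ = R ^ 2 / 2 / (1 - r) * r ^ ℓ := by ring
  · rw [abs_mul, mul_assoc R]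
    exact mul_le_mul (hH.vol_le θ hθ) (hH.abs_riskCoeff_le hθ ℓ) (abs_nonneg _) hR

/-- The error obeys `e (ℓ + 1) = ϱ e ℓ + (x ℓ - m)`. The bound `D r ^ ℓ` propagates once `|ϱ| D + C
≤ D r`, which fixes the size of `D` and uses `|ϱ| < r`. -/
lemma exists_ar_bound {ϱ r C m : ℝ} {x : ℕ → ℝ} (hϱ : |ϱ| < r) (hr : r < 1) (hC : 0 ≤ C)
    (hx : ∀ ℓ, |x ℓ - m| ≤ C * r ^ ℓ) :
    ∃ C', 0 ≤ C' ∧ ∀ ℓ, |ar ϱ x ℓ - m / (1 - ϱ)| ≤ C' * r ^ ℓ := by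
  have h0 : 0 < r - |ϱ| := sub_pos.2 hϱ
  have hne : 1 - ϱ ≠ 0 := by have := le_abs_self ϱ; linarith
  have hr0 : 0 < r := (abs_nonneg _).trans_lt hϱ
  refine ⟨|m / (1 - ϱ)| + C / (r - |ϱ|), by positivity, fun ℓ => ?_⟩
  set D := |m / (1 - ϱ)| + C / (r - |ϱ|) with hD
  have hCD : C ≤ D * (r - |ϱ|) := by
    have : C / (r - |ϱ|) ≤ D := by rw [hD]; linarith [abs_nonneg (m / (1 - ϱ))]
    exact (div_le_iff₀ h0).1 this
  induction ℓ with
  | zero =>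
    simp only [ar, zero_sub, abs_neg, pow_zero, mul_one, hD]
    linarith [div_nonneg hC h0.le]
  | succ ℓ ih =>
    have e : ar ϱ x (ℓ + 1) - m / (1 - ϱ) = ϱ * (ar ϱ x ℓ - m / (1 - ϱ)) + (x ℓ - m) := by
      rw [ar]; field_simp; ring
    rw [e]
    refine (abs_add_le _ _).trans ?_
    rw [abs_mul]
    calc |ϱ| * |ar ϱ x ℓ - m / (1 - ϱ)| + |x ℓ - m| ≤ |ϱ| * (D * r ^ ℓ) + C * r ^ ℓ := by
          gcongr; exact hx ℓ
      _ ≤ |ϱ| * (D * r ^ ℓ) + D * (r - |ϱ|) * r ^ ℓ := by gcongr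
      _ = D * r ^ (ℓ + 1) := by ring

lemma ParamBounds.exists_meanGap_bound (hH : ParamBounds H R r₀ r) {θ₀ : Param J} (hθ₀ : θ₀ ∈ H) :
    ∃ C, 0 ≤ C ∧ ∀ θ ∈ H, ∀ ℓ, |meanGap θ₀ θ ℓ - gapLimit θ₀ θ| ≤ C * r ^ ℓ := by
  obtain ⟨C, hC, h⟩ := hH.exists_innovationMean_bound
  obtain ⟨D, hD, h'⟩ := exists_ar_bound ((hH.auto_le θ₀ hθ₀).trans_lt hH.lt) hH.lt_one hC (h θ₀ hθ₀)
  refine ⟨C + C + 2 * D, by positivity, fun θ hθ ℓ => ?_⟩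
  have e : meanGap θ₀ θ ℓ - gapLimit θ₀ θ =
      (innovationMean θ₀ ℓ - innovationLimit θ₀) - (innovationMean θ ℓ - innovationLimit θ)
      - (θ.2.1 - θ₀.2.1) *
        (ar θ₀.2.1 (innovationMean θ₀) ℓ - innovationLimit θ₀ / (1 - θ₀.2.1)) := by
    rw [meanGap, gapLimit]; ring
  have h2 : |θ.2.1 - θ₀.2.1| ≤ 2 := by
    refine (abs_sub _ _).trans ?_
    have := hH.auto_le θ hθ
    have := hH.auto_le θ₀ hθ₀
    have := hH.lt
    have := hH.lt_one
    linarith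
  rw [e]
  refine (abs_sub _ _).trans ?_
  refine (add_le_add ((abs_sub _ _).trans (add_le_add (h θ₀ hθ₀ ℓ) (h θ hθ ℓ))) le_rfl).trans ?_
  rw [abs_mul]
  have h3 := mul_le_mul h2 (h' ℓ) (abs_nonneg _) zero_le_two
  linarith

/-- The market prices of risk do not affect the limit, which depends on `β²` and `ϱ` only and is
smooth on the compact range. Hence the persistent part of the mean gap carries a factor that the
curvature in `β²` and `ϱ` can absorb. -/
lemma ParamBounds.exists_gapLimit_bound (hH : ParamBounds H R r₀ r) {θ₀ : Param J}
    (hθ₀ : θ₀ ∈ H) :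
    ∃ C, 0 ≤ C ∧ ∀ θ ∈ H,
      |gapLimit θ₀ θ| ≤ C * (|θ.1 ^ 2 - θ₀.1 ^ 2| + |θ.2.1 - θ₀.2.1|) := by
  have hr1 : 0 < 1 - r := sub_pos.2 hH.lt_one
  have hR : 0 ≤ R := zero_le_one.trans hH.one_le
  have h0 := hH.one_sub_le hθ₀
  have hv : θ₀.1 ^ 2 ≤ R ^ 2 := by
    rw [← sq_abs]; have := hH.vol_le θ₀ hθ₀; gcongr
  refine ⟨1 / (2 * (1 - r)) + R ^ 2 / (2 * (1 - r) ^ 2) + R ^ 2 / (2 * (1 - r) ^ 2),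
    by positivity, fun θ hθ => ?_⟩
  have h1 := hH.one_sub_le hθ
  have n0 : 0 < 1 - θ₀.2.1 := by linarith
  have n1 : 0 < 1 - θ.2.1 := by linarith
  have e : gapLimit θ₀ θ = -((θ.1 ^ 2 - θ₀.1 ^ 2) * (1 / (2 * (1 - θ.2.1))))
      - (θ.2.1 - θ₀.2.1) * (θ₀.1 ^ 2 / (2 * ((1 - θ.2.1) * (1 - θ₀.2.1))))
      - (θ.2.1 - θ₀.2.1) * (θ₀.1 ^ 2 / (2 * (1 - θ₀.2.1) ^ 2)) := by
    rw [gapLimit, innovationLimit, innovationLimit]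
    field_simp
    ring
  set g := |θ.1 ^ 2 - θ₀.1 ^ 2|
  set d := |θ.2.1 - θ₀.2.1|
  have hg : 0 ≤ g := abs_nonneg _
  have hd : 0 ≤ d := abs_nonneg _
  have b1 : |1 / (2 * (1 - θ.2.1))| ≤ 1 / (2 * (1 - r)) := by
    rw [abs_of_pos (by positivity)]; gcongr
  have b2 : |θ₀.1 ^ 2 / (2 * ((1 - θ.2.1) * (1 - θ₀.2.1)))| ≤ R ^ 2 / (2 * (1 - r) ^ 2) := by
    rw [abs_of_nonneg (by positivity), sq (1 - r)]; gcongr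
  have b3 : |θ₀.1 ^ 2 / (2 * (1 - θ₀.2.1) ^ 2)| ≤ R ^ 2 / (2 * (1 - r) ^ 2) := by
    rw [abs_of_nonneg (by positivity)]; gcongr
  rw [e]
  refine (abs_sub _ _).trans ((add_le_add_left (abs_sub _ _) _).trans ?_)
  rw [abs_neg, abs_mul, abs_mul, abs_mul]
  set A := 1 / (2 * (1 - r))
  set B := R ^ 2 / (2 * (1 - r) ^ 2)
  have hA : 0 ≤ A := by positivity
  have hB : 0 ≤ B := by positivity
  have c1 := mul_le_mul_of_nonneg_left b1 hg
  have c2 := mul_le_mul_of_nonneg_left b2 hd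
  have c3 := mul_le_mul_of_nonneg_left b3 hd
  have := mul_nonneg hA hd
  have := mul_nonneg hB hg
  linarith

end

/-! ### The quadratic inequality satisfied by likelihood maximisers. -/

/-- A bound for the contribution to the likelihood of terms which decay geometrically in the
time to maturity. -/
def decayStat (r : ℝ) (K L : ℕ) (ξ : ℕ → ℕ → ℝ) : ℝ :=
  ∑ ℓ ∈ Finset.range L, r ^ ℓ * |∑ k ∈ Finset.range K, ξ k ℓ| +
    ∑ k ∈ Finset.range K, 1 / ((k : ℝ) + 1) * (|diagSum ξ L k| * diagSum (fun _ ℓ => r ^ ℓ) L k)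

/-- The absolute values sit on the noise sums, so the right side depends on `ε` only through its
envelope. This permits parameters that depend on the noise. -/
lemma abs_pairing_le_decayStat {C r : ℝ} {ε : ℕ → ℝ}
    (hε : ∀ ℓ, |ε ℓ| ≤ C * r ^ ℓ) (K L : ℕ) (ξ : ℕ → ℕ → ℝ) :
    |pairing K L ξ (fun _ ℓ => ε ℓ)| ≤ C * decayStat r K L ξ := by
  rw [pairing, decayStat, mul_add]
  refine (abs_add_le _ _).trans (add_le_add ?_ ?_)
  · rw [Finset.sum_comm, Finset.mul_sum]
    refine (Finset.abs_sum_le_sum_abs _ _).trans (Finset.sum_le_sum fun ℓ _ => ?_)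
    rw [← Finset.sum_mul, abs_mul]
    have := mul_le_mul_of_nonneg_left (hε ℓ) (abs_nonneg (∑ k ∈ Finset.range K, ξ k ℓ))
    linarith
  · rw [Finset.mul_sum]
    refine (Finset.abs_sum_le_sum_abs _ _).trans (Finset.sum_le_sum fun k _ => ?_)
    have h1 : |diagSum (fun _ ℓ => ε ℓ) L k| ≤ C * diagSum (fun _ ℓ => r ^ ℓ) L k := by
      rw [diagSum, diagSum, Finset.mul_sum]
      exact (Finset.abs_sum_le_sum_abs _ _).trans (Finset.sum_le_sum fun j _ => hε _)
    rw [abs_mul, abs_mul, abs_of_nonneg (by positivity : (0 : ℝ) ≤ 1 / ((k : ℝ) + 1))]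
    calc 1 / ((k : ℝ) + 1) * (|diagSum ξ L k| * |diagSum (fun _ ℓ => ε ℓ) L k|)
        ≤ 1 / ((k : ℝ) + 1) * (|diagSum ξ L k| * (C * diagSum (fun _ ℓ => r ^ ℓ) L k)) := by
          gcongr
      _ = _ := by ring

lemma pairing_self_ge (K L : ℕ) (v : ℕ → ℕ → ℝ) :
    ∑ k ∈ Finset.range K, ∑ ℓ ∈ Finset.range L, v k ℓ ^ 2 ≤ pairing K L v v := by
  rw [pairing]
  have : 0 ≤ ∑ k ∈ Finset.range K, 1 / ((k : ℝ) + 1) * (diagSum v L k * diagSum v L k) :=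
    Finset.sum_nonneg fun k _ => mul_nonneg (by positivity) (mul_self_nonneg _)
  simp only [sq]
  linarith

/-- The sum of squares is at least the sum of squares around the mean. -/
lemma sum_sq_sub_const_ge {K : ℕ} (hK : 0 < K) (c d : ℝ) (z : ℕ → ℝ) :
    d ^ 2 * (∑ k ∈ Finset.range K, z k ^ 2 - (∑ k ∈ Finset.range K, z k) ^ 2 / K) ≤
      ∑ k ∈ Finset.range K, (c - d * z k) ^ 2 := by
  have hK' : (0 : ℝ) < K := by exact_mod_cast hK
  have e : ∑ k ∈ Finset.range K, (c - d * z k) ^ 2 =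
      K * c ^ 2 - 2 * c * d * ∑ k ∈ Finset.range K, z k
        + d ^ 2 * ∑ k ∈ Finset.range K, z k ^ 2 := by
    rw [Finset.mul_sum, Finset.mul_sum]
    have : (K : ℝ) * c ^ 2 = ∑ k ∈ Finset.range K, c ^ 2 := by simp
    rw [this, ← Finset.sum_sub_distrib, ← Finset.sum_add_distrib]
    exact Finset.sum_congr rfl fun k _ => by ring
  rw [e]
  set s := ∑ k ∈ Finset.range K, z k
  -- The difference of the two sides is this square: the best constant `c` is `d` times the mean of
  -- `z`.
  have h1 : 0 ≤ K * (c - d * s / K) ^ 2 := by positivity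
  have e2 : K * (c - d * s / K) ^ 2 = K * c ^ 2 - 2 * c * d * s + d ^ 2 * (s ^ 2 / K) := by
    field_simp
    ring
  rw [e2] at h1
  linarith

lemma sum_sq_sub_const_ge' (K : ℕ) (c d : ℝ) (z : ℕ → ℝ) :
    K * c ^ 2 / 2 - d ^ 2 * ∑ k ∈ Finset.range K, z k ^ 2 ≤
      ∑ k ∈ Finset.range K, (c - d * z k) ^ 2 := by
  have : (K : ℝ) * c ^ 2 / 2 = ∑ k ∈ Finset.range K, c ^ 2 / 2 := by simp; ring
  rw [this, Finset.mul_sum, ← Finset.sum_sub_distrib]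
  refine Finset.sum_le_sum fun k _ => ?_
  nlinarith [sq_nonneg (c - 2 * d * z k)]

section

variable {J : ℕ} {H : Set (Param J)} {R r₀ r : ℝ}

/-- The sum of squares of an array over `k < K` and `ℓ < L`. -/
def sumSq (K L : ℕ) (z : ℕ → ℕ → ℝ) : ℝ :=
  ∑ ℓ ∈ Finset.range L, ∑ k ∈ Finset.range K, z k ℓ ^ 2

/-- The sum over the columns `ℓ < L` of the squares of the column sums, divided by `K`. -/
def colSq (K L : ℕ) (z : ℕ → ℕ → ℝ) : ℝ :=
  ∑ ℓ ∈ Finset.range L, (∑ k ∈ Finset.range K, z k ℓ) ^ 2 / K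

/-- The sum of squares is used twice, each time with weight one half. Centring all columns removes
the deterministic part and leaves the information about `ϱ`. The first `J + 1` columns retain the
mean gap, hence the information about `b`, at the cost of the negligible sum of squares over these
columns. -/
lemma sum_gap_sq_ge (θ₀ θ : Param J) (ξ : ℕ → ℕ → ℝ) {K L : ℕ} (hK : 0 < K) (hL : J < L) :
    ((θ.2.1 - θ₀.2.1) * θ₀.1) ^ 2 / 2 *
        (sumSq K L (fun k => ar θ₀.2.1 (ξ k)) - colSq K L (fun k => ar θ₀.2.1 (ξ k))
          - sumSq K (J + 1) (fun k => ar θ₀.2.1 (ξ k)))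
      + K / 4 * ∑ ℓ ∈ Finset.range (J + 1), meanGap θ₀ θ ℓ ^ 2 ≤
      pairing K L (gap θ₀ θ ξ) (gap θ₀ θ ξ) := by
  refine le_trans ?_ (pairing_self_ge K L (gap θ₀ θ ξ))
  rw [Finset.sum_comm]
  set d := (θ.2.1 - θ₀.2.1) * θ₀.1 with hd
  set z := fun k => ar θ₀.2.1 (ξ k) with hz
  set Q : ℕ → ℝ := fun ℓ => ∑ k ∈ Finset.range K, gap θ₀ θ ξ k ℓ ^ 2 with hQ
  have h1 : d ^ 2 * (sumSq K L z - colSq K L z) ≤ ∑ ℓ ∈ Finset.range L, Q ℓ := by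
    rw [sumSq, colSq, ← Finset.sum_sub_distrib, Finset.mul_sum]
    exact Finset.sum_le_sum fun ℓ _ => sum_sq_sub_const_ge hK (meanGap θ₀ θ ℓ) d (fun k => z k ℓ)
  have h2 : K / 2 * ∑ ℓ ∈ Finset.range (J + 1), meanGap θ₀ θ ℓ ^ 2 - d ^ 2 * sumSq K (J + 1) z ≤
      ∑ ℓ ∈ Finset.range (J + 1), Q ℓ := by
    rw [sumSq, Finset.mul_sum, Finset.mul_sum, ← Finset.sum_sub_distrib]
    refine Finset.sum_le_sum fun ℓ _ => ?_
    have := sum_sq_sub_const_ge' K (meanGap θ₀ θ ℓ) d (fun k => z k ℓ)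
    calc _ = K * meanGap θ₀ θ ℓ ^ 2 / 2 - d ^ 2 * ∑ k ∈ Finset.range K, z k ℓ ^ 2 := by ring
      _ ≤ _ := this
  have h3 : ∑ ℓ ∈ Finset.range (J + 1), Q ℓ ≤ ∑ ℓ ∈ Finset.range L, Q ℓ :=
    Finset.sum_le_sum_of_subset_of_nonneg (Finset.range_subset_range.2 hL)
      fun ℓ _ _ => Finset.sum_nonneg fun k _ => sq_nonneg _
  linarith

lemma pairing_gap (θ₀ θ : Param J) (ξ : ℕ → ℕ → ℝ) (K L : ℕ) :
    pairing K L ξ (gap θ₀ θ ξ) =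
      gapLimit θ₀ θ * pairing K L ξ (fun _ _ => 1)
      - (θ.2.1 - θ₀.2.1) * θ₀.1 * pairing K L ξ (fun k => ar θ₀.2.1 (ξ k))
      + pairing K L ξ (fun _ ℓ => meanGap θ₀ θ ℓ - gapLimit θ₀ θ) := by
  rw [sub_eq_add_neg, ← neg_mul, ← pairing_const_mul_right, ← pairing_const_mul_right,
    ← pairing_add_right, ← pairing_add_right]
  congr 1
  ext k ℓ
  rw [gap]; ring

/-- All parameters with likelihood at least that of the true one satisfy a quadratic inequality
whose coefficients are statistics of the noise. -/
theorem ParamBounds.exists_quadratic_bound (hH : ParamBounds H R r₀ r) {θ₀ : Param J}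
    (hθ₀ : θ₀ ∈ H) :
    ∃ C : ℝ, 0 ≤ C ∧ ∀ x ξ : ℕ → ℕ → ℝ,
      (∀ k ℓ, x (k + 1) ℓ - x k (ℓ + 1) =
        ar θ₀.2.1 (fun i => innovationMean θ₀ i + θ₀.1 * ξ k i) (ℓ + 1)) →
      ∀ K L : ℕ, 0 < K → J < L → ∀ θ ∈ H,
      logLikelihood K L x θ₀.1 θ₀.2.1 θ₀.2.2 ≤ logLikelihood K L x θ.1 θ.2.1 θ.2.2 →
      K * L * (θ.1 ^ 2 - θ₀.1 ^ 2) ^ 2 / (4 * R ^ 2)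
        + (θ₀.1 * (θ.2.1 - θ₀.2.1)) ^ 2 / 2 *
          (sumSq K L (fun k => ar θ₀.2.1 (ξ k)) - colSq K L (fun k => ar θ₀.2.1 (ξ k))
            - sumSq K (J + 1) (fun k => ar θ₀.2.1 (ξ k)))
        + K / 4 * ∑ ℓ ∈ Finset.range (J + 1), meanGap θ₀ θ ℓ ^ 2 ≤
      C * ((|θ.1 ^ 2 - θ₀.1 ^ 2| + |θ.2.1 - θ₀.2.1|) *
        (|pairing K L ξ ξ - K * (L + 1)| + |pairing K L ξ (fun _ _ => 1)|
          + |pairing K L ξ (fun k => ar θ₀.2.1 (ξ k))|) + decayStat r K L ξ) := by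
  have hR1 := hH.one_le
  have hR : 0 < R := zero_lt_one.trans_le hR1
  obtain ⟨C₁, hC₁, hmean⟩ := hH.exists_meanGap_bound hθ₀
  obtain ⟨C₂, hC₂, hlim⟩ := hH.exists_gapLimit_bound hθ₀
  refine ⟨1 + 2 * R * C₂ + 2 * R ^ 2 + 2 * R * C₁, by positivity,
    fun x ξ hx K L hK hL θ hθ hle => ?_⟩
  have hbasic := basic_inequality hx (hH.vol_ne θ₀ hθ₀) (hH.vol_ne θ hθ) (by omega) hle
  have hgap := sum_gap_sq_ge θ₀ θ ξ hK hL
  have hdecay := abs_pairing_le_decayStat (hmean θ hθ) K L ξ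
  have hlim := hlim θ hθ
  rw [pairing_gap] at hbasic
  have hβ₀ := hH.vol_le θ₀ hθ₀
  have hβ := hH.vol_le θ hθ
  have hβpos := abs_pos.2 (hH.vol_ne θ hθ)
  have h1 : K * L * (θ.1 ^ 2 - θ₀.1 ^ 2) ^ 2 / (4 * R ^ 2) ≤
      (K : ℝ) * (L + 1) * ((θ.1 ^ 2 - θ₀.1 ^ 2) ^ 2 / (|θ.1| + |θ₀.1|) ^ 2) := by
    rw [mul_div_assoc]
    have h2 : (|θ.1| + |θ₀.1|) ^ 2 ≤ 4 * R ^ 2 := by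
      rw [show 4 * R ^ 2 = (R + R) ^ 2 by ring]; gcongr
    gcongr
    linarith
  have hK0 : (0 : ℝ) ≤ decayStat r K L ξ := by
    have := hH.pos
    refine add_nonneg (Finset.sum_nonneg fun _ _ => by positivity)
      (Finset.sum_nonneg fun k _ => mul_nonneg (by positivity) (mul_nonneg (abs_nonneg _) ?_))
    exact Finset.sum_nonneg fun _ _ => by positivity
  set g := θ.1 ^ 2 - θ₀.1 ^ 2
  set d := θ.2.1 - θ₀.2.1
  set t₁ := pairing K L ξ ξ - K * (L + 1)
  set t₂ := pairing K L ξ (fun _ _ => 1)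
  set t₃ := pairing K L ξ (fun k => ar θ₀.2.1 (ξ k))
  set t₄ := pairing K L ξ (fun _ ℓ => meanGap θ₀ θ ℓ - gapLimit θ₀ θ)
  set D := decayStat r K L ξ
  -- The first three cross terms carry a factor `g` or `d`. The last one need not be small when `g`
  -- and `d` are, since it also depends on `b`; it is bounded by `decayStat` alone.
  have b1 : g * t₁ ≤ |g| * |t₁| := (le_abs_self _).trans (abs_mul _ _).le
  have b2 : -(2 * θ₀.1 * (gapLimit θ₀ θ * t₂)) ≤ 2 * R * (C₂ * (|g| + |d|) * |t₂|) := by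
    refine (neg_le_abs _).trans ?_
    rw [abs_mul, abs_mul, abs_mul, abs_two]
    gcongr
  have b3 : 2 * θ₀.1 * (d * θ₀.1 * t₃) ≤ 2 * R * (|d| * R * |t₃|) := by
    refine (le_abs_self _).trans ?_
    rw [abs_mul, abs_mul, abs_mul, abs_mul, abs_two]
    gcongr
  have b4 : -(2 * θ₀.1 * t₄) ≤ 2 * R * (C₁ * D) := by
    refine (neg_le_abs _).trans ?_
    rw [abs_mul, abs_mul, abs_two]
    gcongr
  have e : (θ₀.1 * d) ^ 2 = (d * θ₀.1) ^ 2 := by ring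
  rw [e]
  have hg := abs_nonneg g
  have hd := abs_nonneg d
  have p1 := abs_nonneg t₁
  have p2 := abs_nonneg t₂
  have p3 := abs_nonneg t₃
  have key : |g| * |t₁| + 2 * R * (C₂ * (|g| + |d|) * |t₂|) + 2 * R * (|d| * R * |t₃|)
      + 2 * R * (C₁ * D) ≤
      (1 + 2 * R * C₂ + 2 * R ^ 2 + 2 * R * C₁) *
        ((|g| + |d|) * (|t₁| + |t₂| + |t₃|) + D) := by
    set G := |g| + |d| with hG
    have hG0 : 0 ≤ G := add_nonneg hg hd
    set E := (1 + 2 * R * C₂ + 2 * R ^ 2 + 2 * R * C₁) with hE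
    have e1 : 1 ≤ E := by rw [hE]; linarith [mul_nonneg hR.le hC₂, mul_nonneg hR.le hC₁, sq_nonneg R]
    have e2 : 2 * R * C₂ ≤ E := by rw [hE]; linarith [mul_nonneg hR.le hC₁, sq_nonneg R]
    have e3 : 2 * R ^ 2 ≤ E := by rw [hE]; linarith [mul_nonneg hR.le hC₂, mul_nonneg hR.le hC₁]
    have e4 : 2 * R * C₁ ≤ E := by rw [hE]; linarith [mul_nonneg hR.le hC₂, sq_nonneg R]
    have f1 : |g| * |t₁| ≤ E * (G * |t₁|) := by
      calc |g| * |t₁| ≤ G * |t₁| := by gcongr; linarith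
        _ ≤ E * (G * |t₁|) := le_mul_of_one_le_left (by positivity) e1
    have f2 : 2 * R * (C₂ * G * |t₂|) ≤ E * (G * |t₂|) := by
      calc 2 * R * (C₂ * G * |t₂|) = 2 * R * C₂ * (G * |t₂|) := by ring
        _ ≤ _ := by gcongr
    have f3 : 2 * R * (|d| * R * |t₃|) ≤ E * (G * |t₃|) := by
      calc 2 * R * (|d| * R * |t₃|) = 2 * R ^ 2 * (|d| * |t₃|) := by ring
        _ ≤ E * (G * |t₃|) := by gcongr; linarith
    have f4 : 2 * R * (C₁ * D) ≤ E * D := by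
      calc 2 * R * (C₁ * D) = 2 * R * C₁ * D := by ring
        _ ≤ _ := by gcongr
    linarith
  linarith

end

/-! ### Identification of the parameters. -/

section

variable {J : ℕ}

lemma continuous_innovationMean (ℓ : ℕ) : Continuous fun θ : Param J => innovationMean θ ℓ := by
  have h1 : Continuous fun θ : Param J => riskCoeff θ.2.1 θ.2.2 ℓ := by
    refine continuous_finsetSum _ fun j _ => ?_
    split_ifs
    · fun_prop
    · exact continuous_const
  have h2 : Continuous fun θ : Param J => geomSum θ.2.1 (2 * ℓ + 1) :=
    continuous_finsetSum _ fun j _ => by fun_prop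
  unfold innovationMean
  fun_prop

lemma continuous_meanGap (θ₀ : Param J) (ℓ : ℕ) : Continuous fun θ : Param J => meanGap θ₀ θ ℓ := by
  have := continuous_innovationMean (J := J) ℓ
  unfold meanGap
  fun_prop

/-- The distance from the true parameters that the likelihood can see. -/
def contrast (θ₀ θ : Param J) : ℝ :=
  (θ.1 ^ 2 - θ₀.1 ^ 2) ^ 2 + (θ.2.1 - θ₀.2.1) ^ 2
    + ∑ ℓ ∈ Finset.range (J + 1), meanGap θ₀ θ ℓ ^ 2

lemma contrast_nonneg (θ₀ θ : Param J) : 0 ≤ contrast θ₀ θ :=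
  add_nonneg (by positivity) (Finset.sum_nonneg fun _ _ => sq_nonneg _)

lemma continuous_contrast (θ₀ : Param J) : Continuous (contrast θ₀) := by
  refine Continuous.add (by fun_prop) (continuous_finsetSum _ fun ℓ _ => ?_)
  exact (continuous_meanGap θ₀ ℓ).pow 2

/-- Back substitution: each summand with `j > ℓ` in the first coefficient is `ϱ` times the one in
the second, so only `j = ℓ` survives. The risk coefficients therefore determine `b`, whatever `ϱ`
is. -/
lemma riskCoeff_sub (ϱ : ℝ) (b : Fin (J + 1) → ℝ) (ℓ : Fin (J + 1)) :
    riskCoeff ϱ b ℓ - ϱ * riskCoeff ϱ b (ℓ + 1) = b ℓ := by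
  rw [riskCoeff, riskCoeff, Finset.mul_sum, ← Finset.sum_sub_distrib,
    Finset.sum_eq_single ℓ]
  · simp
  · intro j _ hj
    have hj' : (j : ℕ) ≠ ℓ := fun h => hj (Fin.ext h)
    by_cases h : (ℓ : ℕ) ≤ j
    · rw [if_pos h, if_pos (by omega), show (j : ℕ) - ℓ = (j - (ℓ + 1)) + 1 by omega, pow_succ]
      ring
    · rw [if_neg h, if_neg (by omega)]; ring
  · simp

lemma riskCoeff_eq_zero (ϱ : ℝ) (b : Fin (J + 1) → ℝ) {ℓ : ℕ} (h : J < ℓ) :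
    riskCoeff ϱ b ℓ = 0 :=
  Finset.sum_eq_zero fun j _ => if_neg (by omega)

/-- The likelihood identifies the parameters up to a simultaneous sign change of `β` and `b`. -/
lemma eq_or_eq_neg_of_contrast_eq_zero {θ₀ θ : Param J} (h0 : θ₀.1 ≠ 0)
    (h : contrast θ₀ θ = 0) : θ = θ₀ ∨ θ = (-θ₀.1, θ₀.2.1, -θ₀.2.2) := by
  have hs : 0 ≤ ∑ ℓ ∈ Finset.range (J + 1), meanGap θ₀ θ ℓ ^ 2 :=
    Finset.sum_nonneg fun _ _ => sq_nonneg _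
  rw [contrast] at h
  have h1 := sq_nonneg (θ.1 ^ 2 - θ₀.1 ^ 2)
  have h2 := sq_nonneg (θ.2.1 - θ₀.2.1)
  have hβ : θ.1 ^ 2 - θ₀.1 ^ 2 = 0 := pow_eq_zero_iff two_ne_zero |>.1 (by linarith)
  have hϱ : θ.2.1 - θ₀.2.1 = 0 := pow_eq_zero_iff two_ne_zero |>.1 (by linarith)
  have hm := (Finset.sum_eq_zero_iff_of_nonneg fun _ _ => sq_nonneg _).1
    (show ∑ ℓ ∈ Finset.range (J + 1), meanGap θ₀ θ ℓ ^ 2 = 0 by linarith)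
  have hϱ' : θ.2.1 = θ₀.2.1 := by linarith
  have hβ' : θ.1 ^ 2 = θ₀.1 ^ 2 := by linarith
  have hB : ∀ ℓ, θ.1 * riskCoeff θ₀.2.1 θ.2.2 ℓ = θ₀.1 * riskCoeff θ₀.2.1 θ₀.2.2 ℓ := by
    intro ℓ
    by_cases hℓ : ℓ ≤ J
    · have := pow_eq_zero_iff two_ne_zero |>.1 (hm ℓ (Finset.mem_range.2 (by omega)))
      rw [meanGap, hϱ, zero_mul, innovationMean, innovationMean, hϱ', hβ'] at this
      linarith
    · rw [riskCoeff_eq_zero _ _ (by omega), riskCoeff_eq_zero _ _ (by omega), mul_zero, mul_zero]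
  have hb : ∀ j, θ.1 * θ.2.2 j = θ₀.1 * θ₀.2.2 j := fun j => by
    rw [← riskCoeff_sub θ₀.2.1 θ.2.2 j, ← riskCoeff_sub θ₀.2.1 θ₀.2.2 j]
    linear_combination hB j - θ₀.2.1 * hB (j + 1)
  rcases sq_eq_sq_iff_eq_or_eq_neg.1 hβ' with h3 | h3
  · left
    refine Prod.ext h3 (Prod.ext hϱ' (funext fun j => mul_left_cancel₀ h0 ?_))
    rw [← hb j, h3]
  · right
    refine Prod.ext h3 (Prod.ext hϱ' (funext fun j => mul_left_cancel₀ h0 ?_))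
    have := hb j
    rw [h3] at this
    simp only [Pi.neg_apply]
    linarith

/-- Every cluster point in the compact set `H` has zero contrast by continuity, so it is the true
parameter or its sign-changed twin, and the latter is not in `H`. -/
lemma tendsto_of_contrast {H : Set (Param J)} (hH : IsCompact H) {θ₀ : Param J} (h0 : θ₀.1 ≠ 0)
    (hid : (-θ₀.1, θ₀.2.1, -θ₀.2.2) ∉ H) {θhat : ℕ → Param J} (hmem : ∀ᶠ n in atTop, θhat n ∈ H)
    (h : Tendsto (fun n => contrast θ₀ (θhat n)) atTop (𝓝 0)) :
    Tendsto θhat atTop (𝓝 θ₀) := by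
  refine hH.tendsto_nhds_of_unique_mapClusterPt hmem fun θ hθ hcl => ?_
  have h1 : MapClusterPt (contrast θ₀ θ) atTop (contrast θ₀ ∘ θhat) :=
    MapClusterPt.continuousAt_comp (continuous_contrast θ₀).continuousAt hcl
  have h2 : contrast θ₀ θ = 0 := by
    by_contra hne
    have := h1.clusterPt.neBot
    exact (disjoint_iff.1 ((disjoint_nhds_nhds.2 hne).mono_right h)) ▸ this |>.ne rfl
  rcases eq_or_eq_neg_of_contrast_eq_zero h0 h2 with h3 | h3
  · exact h3
  · exact absurd (h3 ▸ hθ) hid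

end

/-! ### Deterministic consistency, given the limits of the noise statistics. -/

/-- The noise is recovered as `ξ k ℓ = z (ℓ + 1) - ϱ z ℓ`. A lower bound for the squares of the
AR(1) field thus follows from the law of large numbers for the squared noise, without computing the
asymptotic variance of the field. -/
lemma sumSq_le_sumSq_ar {ϱ : ℝ} (hϱ : |ϱ| ≤ 1) (K L : ℕ) (ξ : ℕ → ℕ → ℝ) :
    sumSq K L ξ ≤ 4 * (sumSq K L (fun k => ar ϱ (ξ k)) +
      ∑ k ∈ Finset.range K, ar ϱ (ξ k) L ^ 2) := by
  have h1 : sumSq K L ξ ≤ 2 * sumSq K L (fun k => ar ϱ (ξ k)) +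
      2 * ∑ ℓ ∈ Finset.range L, ∑ k ∈ Finset.range K, ar ϱ (ξ k) (ℓ + 1) ^ 2 := by
    simp only [sumSq, Finset.mul_sum, ← Finset.sum_add_distrib]
    refine Finset.sum_le_sum fun ℓ _ => Finset.sum_le_sum fun k _ => ?_
    have e : ξ k ℓ = ar ϱ (ξ k) (ℓ + 1) - ϱ * ar ϱ (ξ k) ℓ := by rw [ar]; ring
    have h2 : (ϱ * ar ϱ (ξ k) ℓ) ^ 2 ≤ ar ϱ (ξ k) ℓ ^ 2 := by
      rw [mul_pow]
      exact mul_le_of_le_one_left (sq_nonneg _) ((sq_le_one_iff_abs_le_one _).2 hϱ)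
    rw [e]
    nlinarith [sq_nonneg (ar ϱ (ξ k) (ℓ + 1) + ϱ * ar ϱ (ξ k) ℓ)]
  have h3 : ∑ ℓ ∈ Finset.range L, ∑ k ∈ Finset.range K, ar ϱ (ξ k) (ℓ + 1) ^ 2 =
      sumSq K L (fun k => ar ϱ (ξ k)) + ∑ k ∈ Finset.range K, ar ϱ (ξ k) L ^ 2 := by
    have h4 := Finset.sum_range_succ (fun ℓ => ∑ k ∈ Finset.range K, ar ϱ (ξ k) ℓ ^ 2) L
    rw [Finset.sum_range_succ'] at h4
    simpa [ar, sumSq] using h4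
  have h5 : 0 ≤ ∑ k ∈ Finset.range K, ar ϱ (ξ k) L ^ 2 := Finset.sum_nonneg fun _ _ => sq_nonneg _
  rw [h3] at h1
  linarith

/-- The limits of statistics of the noise array on which consistency depends. -/
structure NoiseLimits (ϱ r : ℝ) (J : ℕ) (Kn Ln : ℕ → ℕ) (ξ : ℕ → ℕ → ℝ) : Prop where
  quad : Tendsto (fun n => (pairing (Kn n) (Ln n) ξ ξ - Kn n * (Ln n + 1)) / (n * √n)) atTop (𝓝 0)
  lin : Tendsto (fun n => pairing (Kn n) (Ln n) ξ (fun _ _ => 1) / (n * √n)) atTop (𝓝 0)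
  cross : Tendsto (fun n => pairing (Kn n) (Ln n) ξ (fun k => ar ϱ (ξ k)) / (n * √n)) atTop (𝓝 0)
  decay : Tendsto (fun n => decayStat r (Kn n) (Ln n) ξ / n) atTop (𝓝 0)
  sq : Tendsto (fun n : ℕ => (sumSq (Kn n) (Ln n) ξ - Kn n * Ln n) / (n : ℝ) ^ 2) atTop (𝓝 0)
  col : Tendsto (fun n : ℕ => colSq (Kn n) (Ln n) (fun k => ar ϱ (ξ k)) / (n : ℝ) ^ 2) atTop (𝓝 0)
  head : Tendsto (fun n : ℕ => sumSq (Kn n) (J + 1) (fun k => ar ϱ (ξ k)) / (n : ℝ) ^ 2)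
    atTop (𝓝 0)
  last : Tendsto (fun n : ℕ => (∑ k ∈ Finset.range (Kn n), ar ϱ (ξ k) (Ln n) ^ 2) / (n : ℝ) ^ 2)
    atTop (𝓝 0)

lemma NoiseLimits.eventually_sumSq_ge {ϱ r : ℝ} {J : ℕ} {Kn Ln : ℕ → ℕ} {ξ : ℕ → ℕ → ℝ}
    (h : NoiseLimits ϱ r J Kn Ln ξ) (hϱ : |ϱ| ≤ 1) {c : ℝ} (hc : 0 < c)
    (hK : ∀ᶠ n : ℕ in atTop, c * n ≤ Kn n) (hL : ∀ᶠ n : ℕ in atTop, c * n ≤ Ln n) :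
    ∀ᶠ n : ℕ in atTop, c ^ 2 / 16 * (n : ℝ) ^ 2 ≤
      sumSq (Kn n) (Ln n) (fun k => ar ϱ (ξ k)) - colSq (Kn n) (Ln n) (fun k => ar ϱ (ξ k))
        - sumSq (Kn n) (J + 1) (fun k => ar ϱ (ξ k)) := by
  have hlim := (((h.sq.div_const 4).sub h.last).sub h.col).sub h.head
  simp only [zero_div, sub_zero] at hlim
  filter_upwards [hlim.eventually_const_le (show -(c ^ 2 / 8) < 0 by
    have : 0 < c ^ 2 := by positivity
    linarith), hK, hL, eventually_ge_atTop 1] with n h1 hK hL hn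
  have hn0 : (0 : ℝ) < n := by exact_mod_cast hn
  have h2 := sumSq_le_sumSq_ar hϱ (Kn n) (Ln n) ξ
  have hKL : c ^ 2 * (n : ℝ) ^ 2 ≤ (Kn n : ℝ) * Ln n := by
    calc c ^ 2 * (n : ℝ) ^ 2 = (c * n) * (c * n) := by ring
      _ ≤ _ := mul_le_mul hK hL (by positivity) (by positivity)
  rw [div_right_comm, ← sub_div, ← sub_div, ← sub_div, le_div_iff₀ (by positivity)] at h1
  nlinarith [sq_nonneg (c * n)]

/-- With `a = (|g| + |d|) √n`, the cross term is at most `c a² / 4` plus a multiple of `(t /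
n^{3/2})²`, and `a² ≤ 2 n (g² + d²)` lets half of the curvature absorb the first part. Dividing by
`n`, the weight of `m`, explains the normalisations of `t` and `D`. -/
lemma quadratic_absorb {c C n g d m t D : ℝ} (hc : 0 < c) (hn : 1 ≤ n) (hm : 0 ≤ m)
    (h : c * (n ^ 2 * (g ^ 2 + d ^ 2) + n * m) ≤ C * ((|g| + |d|) * t + D)) :
    g ^ 2 + d ^ 2 + m ≤ 4 / c * (C ^ 2 / c * (t / (n * √n)) ^ 2 + C * (D / n)) := by
  have hn0 : 0 < n := by linarith
  set s := √n with hs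
  have hs0 : 0 < s := Real.sqrt_pos.2 hn0
  have hss : s ^ 2 = n := Real.sq_sqrt hn0.le
  set τ := t / (n * s) with hτ
  have ht : t = τ * (n * s) := by rw [hτ]; field_simp
  set e := D / n with he
  have hD : D = e * n := by rw [he]; field_simp
  set a := (|g| + |d|) * s with ha
  have ha2 : a ^ 2 ≤ 2 * n * (g ^ 2 + d ^ 2) := by
    rw [ha, mul_pow, hss, ← sq_abs g, ← sq_abs d]
    nlinarith [sq_nonneg (|g| - |d|)]
  have ha3 : g ^ 2 + d ^ 2 ≤ a ^ 2 := by
    rw [ha, mul_pow, hss, ← sq_abs g, ← sq_abs d]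
    nlinarith [abs_nonneg g, abs_nonneg d, mul_nonneg (abs_nonneg g) (abs_nonneg d),
      sq_nonneg (|g| + |d|)]
  have h1 : c * (n * (g ^ 2 + d ^ 2) + m) ≤ C * (a * τ + e) := by
    rw [ht, hD] at h
    have : n * (c * (n * (g ^ 2 + d ^ 2) + m)) ≤ n * (C * (a * τ + e)) := by
      rw [ha]; linarith
    exact le_of_mul_le_mul_left this hn0
  have h2 : C * (a * τ) ≤ c / 4 * a ^ 2 + C ^ 2 / c * τ ^ 2 := by
    have e1 : c / 4 * a ^ 2 + C ^ 2 / c * τ ^ 2 - C * (a * τ) = (c / 2 * a - C * τ) ^ 2 / c := by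
      field_simp; ring
    have : 0 ≤ (c / 2 * a - C * τ) ^ 2 / c := by positivity
    linarith
  have h3 : c / 4 * (g ^ 2 + d ^ 2 + m) ≤ C ^ 2 / c * τ ^ 2 + C * e := by
    nlinarith [mul_nonneg hc.le hm]
  calc g ^ 2 + d ^ 2 + m = 4 / c * (c / 4 * (g ^ 2 + d ^ 2 + m)) := by field_simp
    _ ≤ _ := by gcongr

/-- Consistency of maximum likelihood for noise arrays with the limits in `NoiseLimits`. -/
theorem tendsto_of_noiseLimits {J : ℕ} {H : Set (Param J)} (hH : IsCompact H) {R r₀ r : ℝ}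
    (hb : ParamBounds H R r₀ r) {θ₀ : Param J} (hθ₀ : θ₀ ∈ H)
    (hid : (-θ₀.1, θ₀.2.1, -θ₀.2.2) ∉ H) {Kn Ln : ℕ → ℕ} {c : ℝ} (hc : 0 < c)
    (hK : ∀ᶠ n : ℕ in atTop, c * n ≤ Kn n) (hL : ∀ᶠ n : ℕ in atTop, c * n ≤ Ln n)
    {x ξ : ℕ → ℕ → ℝ}
    (hx : ∀ k ℓ, x (k + 1) ℓ - x k (ℓ + 1) =
        ar θ₀.2.1 (fun i => innovationMean θ₀ i + θ₀.1 * ξ k i) (ℓ + 1))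
    (hξ : NoiseLimits θ₀.2.1 r J Kn Ln ξ) {θhat : ℕ → Param J}
    (hmle : ∀ᶠ n in atTop, IsMLE H (Kn n) (Ln n) x (θhat n)) :
    Tendsto θhat atTop (𝓝 θ₀) := by
  have h0 := hb.vol_ne θ₀ hθ₀
  have hR := hb.one_le
  obtain ⟨C, hC, hquad⟩ := hb.exists_quadratic_bound hθ₀
  set t : ℕ → ℝ := fun n => |pairing (Kn n) (Ln n) ξ ξ - Kn n * (Ln n + 1)|
    + |pairing (Kn n) (Ln n) ξ (fun _ _ => 1)|
    + |pairing (Kn n) (Ln n) ξ (fun k => ar θ₀.2.1 (ξ k))| with ht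
  have htlim : Tendsto (fun n => t n / (n * √n)) atTop (𝓝 0) := by
    have := (hξ.quad.abs.add hξ.lin.abs).add hξ.cross.abs
    simp only [abs_zero, add_zero] at this
    refine this.congr fun n => ?_
    have hn : (0 : ℝ) ≤ n * √n := by positivity
    simp only [ht, abs_div, abs_of_nonneg hn]
    ring
  -- The three entries are the curvature constants for `β²`, for `ϱ` and for the mean gaps.
  set c₁ := min (c ^ 2 / (4 * R ^ 2)) (min (θ₀.1 ^ 2 / 2 * (c ^ 2 / 16)) (c / 4)) with hc₁
  have hc₁pos : 0 < c₁ := by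
    have : 0 < θ₀.1 ^ 2 := by positivity
    refine lt_min (by positivity) (lt_min (by positivity) (by positivity))
  have hrhs : Tendsto (fun n : ℕ => 4 / c₁ * (C ^ 2 / c₁ * (t n / (n * √n)) ^ 2 +
      C * (decayStat r (Kn n) (Ln n) ξ / n))) atTop (𝓝 0) := by
    have := (((htlim.pow 2).const_mul (C ^ 2 / c₁)).add (hξ.decay.const_mul C)).const_mul (4 / c₁)
    simpa using this
  refine tendsto_of_contrast hH h0 hid (hmle.mono fun n h => h.1) ?_
  refine tendsto_of_tendsto_of_tendsto_of_le_of_le' tendsto_const_nhds hrhs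
    (.of_forall fun n => contrast_nonneg _ _) ?_
  have hϱ : |θ₀.2.1| ≤ 1 := (hb.auto_le θ₀ hθ₀).trans (hb.lt.trans hb.lt_one).le
  have hLJ : ∀ᶠ n : ℕ in atTop, (J : ℝ) < c * n :=
    (tendsto_natCast_atTop_atTop.const_mul_atTop hc).eventually_gt_atTop _
  filter_upwards [hmle, hK, hL, hLJ, hξ.eventually_sumSq_ge hϱ hc hK hL, eventually_ge_atTop 1]
    with n hmle hK hL hLJ hS hn
  have hn1 : (1 : ℝ) ≤ n := by exact_mod_cast hn
  have hKpos : 0 < Kn n := by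
    have : (0 : ℝ) < Kn n := (by positivity : 0 < c * n).trans_le hK
    exact_mod_cast this
  have hJL : J < Ln n := by exact_mod_cast hLJ.trans_le hL
  have hq := hquad x ξ hx (Kn n) (Ln n) hKpos hJL (θhat n) hmle.1 (hmle.2 hθ₀)
  set g := (θhat n).1 ^ 2 - θ₀.1 ^ 2 with hg
  set d := (θhat n).2.1 - θ₀.2.1 with hd
  set m := ∑ ℓ ∈ Finset.range (J + 1), meanGap θ₀ (θhat n) ℓ ^ 2 with hm
  have hm0 : 0 ≤ m := Finset.sum_nonneg fun _ _ => sq_nonneg _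
  refine quadratic_absorb hc₁pos hn1 hm0 (le_trans ?_ hq)
  have hKL : c ^ 2 * (n : ℝ) ^ 2 ≤ (Kn n : ℝ) * Ln n := by
    calc c ^ 2 * (n : ℝ) ^ 2 = (c * n) * (c * n) := by ring
      _ ≤ _ := mul_le_mul hK hL (by positivity) (by positivity)
  have k1 : c₁ ≤ c ^ 2 / (4 * R ^ 2) := min_le_left _ _
  have k2 : c₁ ≤ θ₀.1 ^ 2 / 2 * (c ^ 2 / 16) := (min_le_right _ _).trans (min_le_left _ _)
  have k3 : c₁ ≤ c / 4 := (min_le_right _ _).trans (min_le_right _ _)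
  have b1 : c₁ * ((n : ℝ) ^ 2 * g ^ 2) ≤ Kn n * Ln n * g ^ 2 / (4 * R ^ 2) := by
    calc c₁ * ((n : ℝ) ^ 2 * g ^ 2) ≤ c ^ 2 / (4 * R ^ 2) * ((n : ℝ) ^ 2 * g ^ 2) := by gcongr
      _ = c ^ 2 * (n : ℝ) ^ 2 * g ^ 2 / (4 * R ^ 2) := by ring
      _ ≤ _ := by gcongr
  have b2 := mul_le_mul_of_nonneg_left hS (show 0 ≤ (θ₀.1 * d) ^ 2 / 2 by positivity)
  have b3 : c₁ * ((n : ℝ) ^ 2 * d ^ 2) ≤ (θ₀.1 * d) ^ 2 / 2 * (c ^ 2 / 16 * (n : ℝ) ^ 2) := by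
    calc c₁ * ((n : ℝ) ^ 2 * d ^ 2) ≤ θ₀.1 ^ 2 / 2 * (c ^ 2 / 16) * ((n : ℝ) ^ 2 * d ^ 2) := by
          gcongr
      _ = _ := by ring
  have b4 : c₁ * (n * m) ≤ Kn n / 4 * m := by
    calc c₁ * (n * m) ≤ c / 4 * (n * m) := by gcongr
      _ = c * n / 4 * m := by ring
      _ ≤ _ := by gcongr
  linarith

/-! ### Fourth moments and almost sure convergence. -/

section

variable {Ω : Type*} [MeasurableSpace Ω] {P : Measure Ω}

/-- The `L⁴` norm of `X` is at most `B`. -/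
structure NormLe (P : Measure Ω) (X : Ω → ℝ) (B : ℝ) : Prop where
  aesm : AEStronglyMeasurable X P
  nonneg : 0 ≤ B
  le : eLpNorm X 4 P ≤ ENNReal.ofReal B

namespace NormLe

variable {X Y : Ω → ℝ} {A B : ℝ}

lemma memLp (h : NormLe P X B) : MemLp X 4 P := ⟨h.aesm, h.le.trans_lt ENNReal.ofReal_lt_top⟩

lemma mono (h : NormLe P X A) (hAB : A ≤ B) : NormLe P X B :=
  ⟨h.aesm, h.nonneg.trans hAB, h.le.trans (ENNReal.ofReal_le_ofReal hAB)⟩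

lemma add (hX : NormLe P X A) (hY : NormLe P Y B) : NormLe P (fun ω => X ω + Y ω) (A + B) where
  aesm := hX.aesm.add hY.aesm
  nonneg := add_nonneg hX.nonneg hY.nonneg
  le := by
    rw [ENNReal.ofReal_add hX.nonneg hY.nonneg]
    exact (eLpNorm_add_le hX.aesm hY.aesm (by norm_num)).trans (add_le_add hX.le hY.le)

lemma zero : NormLe P (fun _ => 0) 0 := ⟨aestronglyMeasurable_const, le_rfl, by simp⟩

lemma const_mul (c : ℝ) (hX : NormLe P X A) : NormLe P (fun ω => c * X ω) (|c| * A) where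
  aesm := hX.aesm.const_mul c
  nonneg := mul_nonneg (abs_nonneg _) hX.nonneg
  le := by
    rw [ENNReal.ofReal_mul (abs_nonneg _)]
    refine (eLpNorm_const_smul (c := c) (f := X) (p := 4) (μ := P)).le.trans ?_
    rw [Real.enorm_eq_ofReal_abs]
    gcongr
    exact hX.le

lemma sum {ι : Type*} (s : Finset ι) {X : ι → Ω → ℝ} {B : ι → ℝ} (h : ∀ i ∈ s, NormLe P (X i) (B i)) :
    NormLe P (fun ω => ∑ i ∈ s, X i ω) (∑ i ∈ s, B i) := by
  classical
  induction s using Finset.induction_on with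
  | empty => simpa using zero
  | insert i s hi ih =>
    simp only [Finset.sum_insert hi]
    exact (h i (Finset.mem_insert_self _ _)).add (ih fun j hj => h j (Finset.mem_insert_of_mem hj))

lemma of_abs_le (hX : NormLe P X A) (hY : AEStronglyMeasurable Y P) (h : ∀ ω, |Y ω| ≤ |X ω|) :
    NormLe P Y A :=
  ⟨hY, hX.nonneg, (eLpNorm_mono h).trans hX.le⟩

lemma abs (hX : NormLe P X A) : NormLe P (fun ω => |X ω|) A :=
  hX.of_abs_le hX.aesm.norm fun ω => by rw [abs_abs]

lemma const [IsProbabilityMeasure P] (c : ℝ) : NormLe P (fun _ => c) |c| :=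
  ⟨aestronglyMeasurable_const, abs_nonneg _, by
    rw [eLpNorm_const c (by norm_num) (IsProbabilityMeasure.ne_zero P)]
    simp [Real.enorm_eq_ofReal_abs]⟩

/-- The product of two random variables whose squares are bounded. -/
lemma mul (hX : NormLe P (fun ω => X ω ^ 2) A) (hY : NormLe P (fun ω => Y ω ^ 2) B)
    (hXm : AEStronglyMeasurable X P) (hYm : AEStronglyMeasurable Y P) :
    NormLe P (fun ω => X ω * Y ω) (A + B) :=
  (hX.add hY).of_abs_le (hXm.mul hYm) fun ω => by
    rw [abs_of_nonneg (by positivity : 0 ≤ X ω ^ 2 + Y ω ^ 2), abs_mul]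
    nlinarith [sq_nonneg (|X ω| - |Y ω|), sq_abs (X ω), sq_abs (Y ω)]

lemma lintegral_le (h : NormLe P X B) : ∫⁻ ω, ‖X ω‖ₑ ^ 4 ∂P ≤ ENNReal.ofReal (B ^ 4) := by
  have h1 := eLpNorm_nnreal_pow_eq_lintegral (μ := P) (f := X) (p := 4) (by norm_num)
  have h2 : ∫⁻ ω, ‖X ω‖ₑ ^ 4 ∂P = eLpNorm X 4 P ^ 4 := by
    rw [show ((4 : NNReal) : ENNReal) = 4 by norm_num] at h1
    have e : ((4 : NNReal) : ℝ) = ((4 : ℕ) : ℝ) := by norm_num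
    simp only [e, ENNReal.rpow_natCast] at h1
    exact h1.symm
  rw [h2, ENNReal.ofReal_pow h.nonneg]
  gcongr
  exact h.le

lemma integrable (h : NormLe P X B) : Integrable (fun ω => X ω ^ 4) P := by
  have := h.memLp.integrable_norm_pow (p := 4) (by norm_num)
  refine this.congr (.of_forall fun ω => ?_)
  simp only [Real.norm_eq_abs]
  exact Even.pow_abs (by decide) _

lemma integral_le (h : NormLe P X B) : ∫ ω, X ω ^ 4 ∂P ≤ B ^ 4 := by
  have hB := h.nonneg
  rw [integral_eq_lintegral_of_nonneg_ae (.of_forall fun ω => by positivity)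
    h.integrable.aestronglyMeasurable]
  refine ENNReal.toReal_le_of_le_ofReal (by positivity) ?_
  refine le_trans (le_of_eq ?_) h.lintegral_le
  refine lintegral_congr fun ω => ?_
  rw [Real.enorm_eq_ofReal_abs, ← ENNReal.ofReal_pow (abs_nonneg _), Even.pow_abs (by decide)]

lemma of_integral_le (hX : AEStronglyMeasurable X P) (hB : 0 ≤ B)
    (hint : Integrable (fun ω => X ω ^ 4) P) (h : ∫ ω, X ω ^ 4 ∂P ≤ B ^ 4) : NormLe P X B where
  aesm := hX
  nonneg := hB
  le := by
    have h1 := eLpNorm_nnreal_pow_eq_lintegral (μ := P) (f := X) (p := 4) (by norm_num)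
    rw [show ((4 : NNReal) : ENNReal) = 4 by norm_num] at h1
    have e : ((4 : NNReal) : ℝ) = ((4 : ℕ) : ℝ) := by norm_num
    simp only [e, ENNReal.rpow_natCast] at h1
    have h2 : eLpNorm X 4 P ^ 4 ≤ ENNReal.ofReal B ^ 4 := by
      rw [h1, ← ENNReal.ofReal_pow hB]
      refine le_trans (le_of_eq ?_) (ENNReal.ofReal_le_ofReal h)
      rw [ofReal_integral_eq_lintegral_ofReal hint (.of_forall fun ω => by positivity)]
      refine lintegral_congr fun ω => ?_
      rw [Real.enorm_eq_ofReal_abs, ← ENNReal.ofReal_pow (abs_nonneg _), Even.pow_abs (by decide)]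
    exact (ENNReal.pow_le_pow_left_iff (by norm_num)).1 h2

end NormLe

/-- Almost sure convergence from `L⁴` bounds with summable fourth powers. -/
theorem ae_tendsto_zero_of_normLe {Y : ℕ → Ω → ℝ} {B : ℝ}
    (h : ∀ᶠ n : ℕ in atTop, NormLe P (Y n) (B / √n)) :
    ∀ᵐ ω ∂P, Tendsto (fun n => Y n ω) atTop (𝓝 0) := by
  obtain ⟨N, hN⟩ := eventually_atTop.1 h
  have hle : ∀ n, ∫⁻ ω, ‖Y (n + N) ω‖ₑ ^ 4 ∂P ≤ ENNReal.ofReal (B ^ 4 * (1 / ((n + N : ℕ) : ℝ) ^ 2)) := by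
    intro n
    refine (hN (n + N) (by omega)).lintegral_le.trans (le_of_eq ?_)
    congr 1
    rw [div_pow, show √((n + N : ℕ) : ℝ) ^ 4 = (√((n + N : ℕ) : ℝ) ^ 2) ^ 2 by ring,
      Real.sq_sqrt (by positivity)]
    ring
  have hsum : Summable fun n : ℕ => B ^ 4 * (1 / ((n + N : ℕ) : ℝ) ^ 2) := by
    refine Summable.mul_left _ ?_
    exact (summable_nat_add_iff (f := fun n : ℕ => 1 / (n : ℝ) ^ 2) N).2
      (Real.summable_one_div_nat_pow.2 (by norm_num))
  have hm : ∀ n, AEMeasurable (fun ω => ‖Y (n + N) ω‖ₑ ^ 4) P := fun n =>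
    ((hN (n + N) (by omega)).aesm.enorm).pow_const 4
  have hfin : ∫⁻ ω, ∑' n, ‖Y (n + N) ω‖ₑ ^ 4 ∂P ≠ ⊤ := by
    rw [lintegral_tsum hm]
    exact ne_top_of_le_ne_top hsum.tsum_ofReal_ne_top (ENNReal.tsum_le_tsum hle)
  have hae := ae_lt_top' (AEMeasurable.tsum hm) hfin
  filter_upwards [hae] with ω hω
  have h1 := ENNReal.tendsto_atTop_zero_of_tsum_ne_top hω.ne
  have h2 : Tendsto (fun n => Y (n + N) ω ^ 4) atTop (𝓝 0) := by
    have := (ENNReal.tendsto_toReal ENNReal.zero_ne_top).comp h1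
    simp only [ENNReal.toReal_zero] at this
    refine this.congr fun n => ?_
    simp only [Function.comp_apply, ENNReal.toReal_pow, toReal_enorm, Real.norm_eq_abs]
    exact Even.pow_abs (by decide) _
  rw [← tendsto_add_atTop_iff_nat N]
  refine (tendsto_zero_iff_abs_tendsto_zero _).2 ?_
  -- The fourth root, taken as two square roots, recovers `|Y n ω|`.
  have h3 := h2.sqrt.sqrt
  simp only [Real.sqrt_zero] at h3
  refine h3.congr fun n => ?_
  rw [show Y (n + N) ω ^ 4 = (Y (n + N) ω ^ 2) ^ 2 by ring, Real.sqrt_sq (sq_nonneg _),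
    Real.sqrt_sq_eq_abs]
  rfl

/-- A fourth moment bound for sums of martingale difference type. -/
theorem NormLe.sum_range {D : ℕ → Ω → ℝ} {d : ℝ} (hd : 0 ≤ d) (hD : ∀ m, NormLe P (D m) d)
    (horth : ∀ m, ∫ ω, (∑ i ∈ Finset.range m, D i ω) ^ 3 * D m ω ∂P = 0) (M : ℕ) :
    NormLe P (fun ω => ∑ i ∈ Finset.range M, D i ω) (2 * √M * d) := by
  set S : ℕ → Ω → ℝ := fun m ω => ∑ i ∈ Finset.range m, D i ω with hS
  have hSn : ∀ m, NormLe P (S m) (∑ i ∈ Finset.range m, d) := fun m => NormLe.sum _ fun i _ => hD i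
  have key : ∀ m : ℕ, ∫ ω, S m ω ^ 4 ∂P ≤ 16 * (m : ℝ) ^ 2 * d ^ 4 := by
    intro m
    induction m with
    | zero => simp [hS]
    | succ m ih =>
      have hsucc : ∀ ω, S (m + 1) ω = S m ω + D m ω := fun ω => Finset.sum_range_succ _ _
      -- The first step is separate because the Young inequality below has weight `1 / m`.
      rcases Nat.eq_zero_or_pos m with rfl | hm
      · have e : ∀ ω, S (0 + 1) ω ^ 4 = D 0 ω ^ 4 := fun ω => by rw [hsucc]; simp [hS]
        simp only [e]
        refine ((hD 0).integral_le).trans ?_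
        have : 0 ≤ d ^ 4 := by positivity
        norm_num
        linarith
      have hm0 : (0 : ℝ) < m := by exact_mod_cast hm
      have i1 := (hSn m).integrable
      have i2 := (hD m).integrable
      have i3 : Integrable (fun ω => S m ω ^ 3 * D m ω) P := by
        refine (i1.add i2).mono' (((hSn m).aesm.pow 3).mul (hD m).aesm) (.of_forall fun ω => ?_)
        simp only [Real.norm_eq_abs, Pi.add_apply]
        rw [abs_le]
        constructor <;> nlinarith [sq_nonneg (S m ω ^ 2 - D m ω ^ 2), sq_nonneg (S m ω + D m ω),
          sq_nonneg (S m ω - D m ω), sq_nonneg (S m ω ^ 2 + S m ω * D m ω),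
          sq_nonneg (S m ω ^ 2 - S m ω * D m ω), sq_nonneg (S m ω * D m ω), sq_nonneg (S m ω ^ 2)]
      -- The cubic cross term integrates to zero; the others are split so that `S m ^ 4` grows only
      -- by the factor `1 + 1 / m`. The induction closes since `(1 + 1 / m) 16 m² + 16 m + 3 ≤ 16 (m
      -- + 1)²`.
      have hpt : ∀ ω, S (m + 1) ω ^ 4 ≤ (1 + 1 / (m : ℝ)) * S m ω ^ 4 +
          4 * (S m ω ^ 3 * D m ω) + (3 + 16 * m) * D m ω ^ 4 := fun ω => by
        rw [hsucc]
        set s := S m ω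
        set x := D m ω
        have h1 : 8 * (s ^ 2 * x ^ 2) ≤ 1 / m * s ^ 4 + 16 * m * x ^ 4 := by
          have e : 1 / m * s ^ 4 + 16 * m * x ^ 4 - 8 * (s ^ 2 * x ^ 2) =
              (s ^ 2 - 4 * m * x ^ 2) ^ 2 / m := by
            field_simp; ring
          have : 0 ≤ (s ^ 2 - 4 * m * x ^ 2) ^ 2 / m := by positivity
          linarith
        have h2 : 4 * (s * x ^ 3) ≤ 2 * (s ^ 2 * x ^ 2) + 2 * x ^ 4 := by
          nlinarith [sq_nonneg (s * x - x ^ 2)]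
        have e : (s + x) ^ 4 = s ^ 4 + 4 * (s ^ 3 * x) + 6 * (s ^ 2 * x ^ 2) + 4 * (s * x ^ 3)
          + x ^ 4 := by ring
        rw [e]
        linarith
      have hint := integral_mono (hSn (m + 1)).integrable
        (((i1.const_mul (1 + 1 / (m : ℝ))).add (i3.const_mul 4)).add (i2.const_mul (3 + 16 * m))) hpt
      rw [integral_add' ((i1.const_mul _).add (i3.const_mul 4)) (i2.const_mul _),
        integral_add' (i1.const_mul _) (i3.const_mul 4), integral_const_mul, integral_const_mul,
        integral_const_mul, horth m, mul_zero, add_zero] at hint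
      refine hint.trans ?_
      have b1 := mul_le_mul_of_nonneg_left ih (show 0 ≤ 1 + 1 / (m : ℝ) by positivity)
      have b2 := mul_le_mul_of_nonneg_left (hD m).integral_le (show 0 ≤ 3 + 16 * (m : ℝ) by positivity)
      have e : (1 + 1 / (m : ℝ)) * (16 * m ^ 2 * d ^ 4) = (16 * m ^ 2 + 16 * m) * d ^ 4 := by
        field_simp
      have hd4 : 0 ≤ d ^ 4 := by positivity
      push_cast
      nlinarith
  refine NormLe.of_integral_le (hSn M).aesm (by positivity) (hSn M).integrable ((key M).trans ?_)
  have e : √(M : ℝ) ^ 4 = (M : ℝ) ^ 2 := by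
    rw [show √(M : ℝ) ^ 4 = (√(M : ℝ) ^ 2) ^ 2 by ring, Real.sq_sqrt (by positivity)]
  rw [mul_pow, mul_pow, e]
  norm_num

end

/-! ### Moment bounds for Gaussian arrays. -/

lemma ar_eq_sum_range (ϱ : ℝ) (x : ℕ → ℝ) (ℓ : ℕ) :
    ar ϱ x ℓ = ∑ i ∈ Finset.range ℓ, ϱ ^ (ℓ - 1 - i) * x i := by
  cases ℓ with
  | zero => simp [ar]
  | succ ℓ => rw [ar_eq_sum]; rfl

lemma measurable_ar {Ω : Type*} {ξ : ℕ → ℕ → Ω → ℝ} (ϱ : ℝ) (k ℓ : ℕ) :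
    Measurable[sigmaOn ξ {p | p.1 = k ∧ p.2 < ℓ}] fun ω => ar ϱ (fun i => ξ k i ω) ℓ := by
  simp only [ar_eq_sum_range]
  exact Finset.measurable_fun_sum _ fun i hi =>
    (measurable_sigmaOn (by simpa using hi)).const_mul _

section

variable {Ω : Type*} [MeasurableSpace Ω] {P : Measure Ω}

lemma NormLe.comp {X : Ω → ℝ} {g : ℝ → ℝ} {B : ℝ} (h : NormLe (P.map X) g B)
    (hX : AEMeasurable X P) : NormLe P (fun ω => g (X ω)) B where
  aesm := h.aesm.comp_aemeasurable hX
  nonneg := h.nonneg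
  le := by
    have := eLpNorm_map_measure (p := 4) h.aesm hX
    exact this.symm.le.trans h.le

lemma gaussianReal_zero_eq_map (v : NNReal) :
    gaussianReal 0 v = (gaussianReal 0 1).map (fun x => √(v : ℝ) * x) := by
  rw [gaussianReal_map_const_mul, mul_zero, mul_one]
  congr 1
  ext
  simp

/-- A common bound for the `L⁴` norms of a standard normal variable and of its square. -/
def gaussConst : ℝ :=
  max (eLpNorm (fun x : ℝ => x) 4 (gaussianReal 0 1)).toReal
    (eLpNorm (fun x : ℝ => x ^ 2) 4 (gaussianReal 0 1)).toReal

lemma normLe_id_gaussianReal : NormLe (gaussianReal 0 1) (fun x => x) gaussConst := by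
  have h := memLp_id_gaussianReal' (μ := 0) (v := 1) 4 (by norm_num)
  refine ⟨h.1, le_max_of_le_left ENNReal.toReal_nonneg, ?_⟩
  refine ENNReal.le_ofReal_iff_toReal_le h.2.ne (le_max_of_le_left ENNReal.toReal_nonneg) |>.2 ?_
  exact le_max_left _ _

lemma normLe_sq_gaussianReal : NormLe (gaussianReal 0 1) (fun x => x ^ 2) gaussConst := by
  have h8 := memLp_id_gaussianReal' (μ := 0) (v := 1) 8 (by norm_num)
  have h : MemLp (fun x : ℝ => x ^ 2) 4 (gaussianReal 0 1) := by
    -- The square lies in `L⁴` as a product of two factors in `L⁸`.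
    have : ENNReal.HolderTriple 8 8 4 := ⟨by
      rw [← ENNReal.toReal_eq_toReal_iff' (by simp) (by simp), ENNReal.toReal_add (by simp) (by simp)]
      norm_num⟩
    have := h8.mul (r := 4) h8
    refine this.ae_eq (.of_forall fun x => ?_)
    simp [sq]
  refine ⟨h.1, le_max_of_le_left ENNReal.toReal_nonneg, ?_⟩
  refine ENNReal.le_ofReal_iff_toReal_le h.2.ne (le_max_of_le_left ENNReal.toReal_nonneg) |>.2 ?_
  exact le_max_right _ _

lemma gaussConst_nonneg : 0 ≤ gaussConst := normLe_id_gaussianReal.nonneg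

lemma normLe_of_gaussian {X : Ω → ℝ} {v : NNReal} (hX : AEMeasurable X P)
    (h : P.map X = gaussianReal 0 v) : NormLe P X (√v * gaussConst) := by
  refine NormLe.comp (g := fun x => x) ?_ hX
  rw [h, gaussianReal_zero_eq_map]
  have h1 := normLe_id_gaussianReal.const_mul √(v : ℝ)
  rw [abs_of_nonneg (Real.sqrt_nonneg _)] at h1
  refine ⟨aestronglyMeasurable_id, h1.nonneg, ?_⟩
  rw [eLpNorm_map_measure (by fun_prop) (by fun_prop)]
  exact h1.le

lemma normLe_sq_of_gaussian {X : Ω → ℝ} {v : NNReal} (hX : AEMeasurable X P)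
    (h : P.map X = gaussianReal 0 v) : NormLe P (fun ω => X ω ^ 2) (v * gaussConst) := by
  refine NormLe.comp (g := fun x => x ^ 2) ?_ hX
  rw [h, gaussianReal_zero_eq_map]
  have h1 := normLe_sq_gaussianReal.const_mul (v : ℝ)
  rw [abs_of_nonneg v.coe_nonneg] at h1
  refine ⟨by fun_prop, h1.nonneg, ?_⟩
  rw [eLpNorm_map_measure (by fun_prop) (by fun_prop)]
  refine le_trans (le_of_eq ?_) h1.le
  congr 1
  ext x
  simp only [Function.comp_apply, mul_pow, Real.sq_sqrt v.coe_nonneg]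

lemma sum_sq_pow_le {ϱ : ℝ} (hϱ : |ϱ| < 1) (ℓ : ℕ) :
    ∑ i ∈ Finset.range ℓ, (ϱ ^ (ℓ - 1 - i)) ^ 2 ≤ 1 / (1 - ϱ ^ 2) := by
  have h1 : ϱ ^ 2 < 1 := (sq_lt_one_iff_abs_lt_one _).2 hϱ
  rw [Finset.sum_range_reflect (fun i => (ϱ ^ i) ^ 2) ℓ]
  have h2 : ∀ i, (ϱ ^ i) ^ 2 = (ϱ ^ 2) ^ i := fun i => by rw [← pow_mul, ← pow_mul, mul_comm]
  simp only [h2]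
  rw [one_div, ← tsum_geometric_of_lt_one (sq_nonneg ϱ) h1]
  exact (summable_geometric_of_lt_one (sq_nonneg ϱ) h1).sum_le_tsum _ fun i _ => by positivity

variable {ξ : ℕ → ℕ → Ω → ℝ}

namespace IsGaussianArray

lemma map_sum_rows (h : IsGaussianArray P ξ) {X : ℕ → Ω → ℝ} {v : ℕ → NNReal}
    (hX : ∀ j, Measurable[sigmaOn ξ {p | p.1 = j}] (X j))
    (hl : ∀ j, P.map (X j) = gaussianReal 0 (v j)) (s : Finset ℕ) :
    P.map (fun ω => ∑ j ∈ s, X j ω) = gaussianReal 0 (∑ j ∈ s, v j) := by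
  have := h.indep.isProbabilityMeasure
  induction s using Finset.induction_on with
  | empty => simp [Measure.map_const]
  | insert k s hk ih =>
    have hind : IndepFun (X k) (fun ω => ∑ j ∈ s, X j ω) P := by
      refine h.indepFun (S := {p | p.1 = k}) (T := {p | p.1 ∈ s})
        (Set.disjoint_left.2 fun p h1 h2 => ?_) (hX k)
        (Finset.measurable_fun_sum _ fun j hj => (hX j).mono (sigmaOn_mono fun p hp => ?_) le_rfl)
      · simp only [Set.mem_ofPred_eq] at h1 h2
        exact hk (h1 ▸ h2)
      · simp only [Set.mem_ofPred_eq] at hp ⊢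
        exact hp ▸ hj
    have := gaussianReal_add_gaussianReal_of_indepFun hind (hl k) ih
    simp only [Finset.sum_insert hk]
    simpa [Pi.add_def] using this

/-- Distinct rows are independent, so the sum is normal with variance at most the number of rows
over `1 - ϱ²`. The free column choice `e` covers columns (`e` constant) and antidiagonals alike. -/
lemma normLe_sq_sum_ar (h : IsGaussianArray P ξ) {ϱ : ℝ} (hϱ : |ϱ| < 1) (s : Finset ℕ)
    (e : ℕ → ℕ) :
    NormLe P (fun ω => (∑ j ∈ s, ar ϱ (fun i => ξ j i ω) (e j)) ^ 2)
      (s.card * (1 / (1 - ϱ ^ 2)) * gaussConst) := by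
  have hm : ∀ j, Measurable[sigmaOn ξ {p | p.1 = j}] fun ω => ar ϱ (fun i => ξ j i ω) (e j) :=
    fun j => (measurable_ar ϱ j (e j)).mono (sigmaOn_mono fun p hp => hp.1) le_rfl
  have hl : ∀ j, P.map (fun ω => ar ϱ (fun i => ξ j i ω) (e j)) =
      gaussianReal 0 (∑ i ∈ Finset.range (e j), (ϱ ^ (e j - 1 - i)) ^ 2).toNNReal := fun j => by
    simp only [ar_eq_sum_range]
    exact h.map_row_sum j (e j) _
  have h1 := normLe_sq_of_gaussian (Measurable.aemeasurable (Finset.measurable_fun_sum s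
    fun j _ => (hm j).mono (h.sigmaOn_le _) le_rfl)) (h.map_sum_rows hm hl s)
  refine h1.mono ?_
  have := gaussConst_nonneg
  gcongr
  push_cast
  rw [← nsmul_eq_mul]
  refine Finset.sum_le_card_nsmul _ _ _ fun j _ => ?_
  rw [Real.coe_toNNReal _ (Finset.sum_nonneg fun _ _ => sq_nonneg _)]
  exact sum_sq_pow_le hϱ _

lemma normLe_sq_ar (h : IsGaussianArray P ξ) {ϱ : ℝ} (hϱ : |ϱ| < 1) (k ℓ : ℕ) :
    NormLe P (fun ω => ar ϱ (fun i => ξ k i ω) ℓ ^ 2) (1 / (1 - ϱ ^ 2) * gaussConst) := by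
  simpa using h.normLe_sq_sum_ar hϱ {k} fun _ => ℓ

lemma map_sum_entries (h : IsGaussianArray P ξ) (s : Finset ℕ) (e : ℕ → ℕ) :
    P.map (fun ω => ∑ j ∈ s, ξ j (e j) ω) = gaussianReal 0 s.card := by
  have := h.map_sum_rows (X := fun j => ξ j (e j)) (v := fun _ => 1)
    (fun j => measurable_sigmaOn (by simp)) (fun j => h.law _ _) s
  simpa using this

lemma normLe_sum_entries (h : IsGaussianArray P ξ) (s : Finset ℕ) (e : ℕ → ℕ) :
    NormLe P (fun ω => ∑ j ∈ s, ξ j (e j) ω) (√s.card * gaussConst) := by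
  have := normLe_of_gaussian (Measurable.aemeasurable (Finset.measurable_fun_sum s
    fun j _ => h.measurable j (e j))) (h.map_sum_entries s e)
  simpa using this

lemma normLe_sq_sum_entries (h : IsGaussianArray P ξ) (s : Finset ℕ) (e : ℕ → ℕ) :
    NormLe P (fun ω => (∑ j ∈ s, ξ j (e j) ω) ^ 2) (s.card * gaussConst) := by
  have := normLe_sq_of_gaussian (Measurable.aemeasurable (Finset.measurable_fun_sum s
    fun j _ => h.measurable j (e j))) (h.map_sum_entries s e)
  simpa using this

lemma normLe_entry (h : IsGaussianArray P ξ) (k ℓ : ℕ) : NormLe P (ξ k ℓ) gaussConst := by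
  simpa using h.normLe_sum_entries {k} fun _ => ℓ

lemma normLe_sq_entry (h : IsGaussianArray P ξ) (k ℓ : ℕ) :
    NormLe P (fun ω => ξ k ℓ ω ^ 2) gaussConst := by
  simpa using h.normLe_sq_sum_entries {k} fun _ => ℓ

lemma integral_entry (h : IsGaussianArray P ξ) (k ℓ : ℕ) : ∫ ω, ξ k ℓ ω ∂P = 0 := by
  have := integral_map (μ := P) (h.measurable k ℓ).aemeasurable (f := fun x : ℝ => x)
    (by fun_prop)
  rw [← this, h.law, integral_id_gaussianReal]

lemma integral_sq_entry_sub (h : IsGaussianArray P ξ) (k ℓ : ℕ) :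
    ∫ ω, (ξ k ℓ ω ^ 2 - 1) ∂P = 0 := by
  have := h.indep.isProbabilityMeasure
  have h1 := integral_map (μ := P) (h.measurable k ℓ).aemeasurable (f := fun x : ℝ => x ^ 2)
    (by fun_prop)
  have h2 := variance_of_integral_eq_zero (X := fun x : ℝ => x) (μ := gaussianReal 0 1)
    (by fun_prop) integral_id_gaussianReal
  rw [variance_fun_id_gaussianReal] at h2
  have h3 : Integrable (fun ω => ξ k ℓ ω ^ 2) P :=
    (h.normLe_sq_entry k ℓ).memLp.integrable (by norm_num)
  rw [integral_sub h3 (integrable_const _), ← h1, h.law, ← h2]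
  simp

/-- Fourth moment bound for double sums of products `X k ℓ * Y k ℓ`, where `Y k ℓ` is a centred
function of the entry `(k, ℓ)` and `X k ℓ` depends on the preceding entries of the row. -/
lemma normLe_double_sum (h : IsGaussianArray P ξ) {X Y : ℕ → ℕ → Ω → ℝ} {d : ℝ} (hd : 0 ≤ d)
    (hX : ∀ k ℓ, Measurable[sigmaOn ξ {p | p.1 = k ∧ p.2 < ℓ}] (X k ℓ))
    (hY : ∀ k ℓ, Measurable[sigmaOn ξ {p | p.1 = k ∧ p.2 = ℓ}] (Y k ℓ))
    (hY0 : ∀ k ℓ, ∫ ω, Y k ℓ ω ∂P = 0) (hn : ∀ k ℓ, NormLe P (fun ω => X k ℓ ω * Y k ℓ ω) d)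
    (K L : ℕ) :
    NormLe P (fun ω => ∑ k ∈ Finset.range K, ∑ ℓ ∈ Finset.range L, X k ℓ ω * Y k ℓ ω)
      (2 * √K * (2 * √L * d)) := by
  have := h.indep.isProbabilityMeasure
  have hrow : ∀ k ℓ, Measurable[sigmaOn ξ {p | p.1 = k ∧ p.2 < ℓ}]
      fun ω => ∑ i ∈ Finset.range ℓ, X k i ω * Y k i ω := fun k ℓ => by
    refine Finset.measurable_fun_sum _ fun i hi => ?_
    rw [Finset.mem_range] at hi
    refine ((hX k i).mono (sigmaOn_mono fun p hp => ?_) le_rfl).mul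
      ((hY k i).mono (sigmaOn_mono fun p hp => ?_) le_rfl)
    · exact ⟨hp.1, hp.2.trans hi⟩
    · exact ⟨hp.1, hp.2 ▸ hi⟩
  have hdisj : ∀ k ℓ : ℕ, Disjoint {p : ℕ × ℕ | p.1 = k ∧ p.2 < ℓ} {p | p.1 = k ∧ p.2 = ℓ} :=
    fun k ℓ => Set.disjoint_left.2 fun p h1 h2 => (h1.2.trans_eq h2.2.symm).false
  have hinner : ∀ k, NormLe P (fun ω => ∑ ℓ ∈ Finset.range L, X k ℓ ω * Y k ℓ ω) (2 * √L * d) := by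
    intro k
    refine NormLe.sum_range hd (hn k) (fun ℓ => ?_) L
    simp only [← mul_assoc]
    -- The cube of the partial row sum and `X k ℓ` depend on earlier entries only, so the centred
    -- factor `Y k ℓ` is independent of their product.
    exact h.integral_mul_eq_zero (hdisj k ℓ) (((hrow k ℓ).pow_const 3).mul (hX k ℓ)) (hY k ℓ)
      (hY0 k ℓ)
  refine NormLe.sum_range (by positivity) hinner (fun k => ?_) K
  refine h.integral_mul_eq_zero (S := {p | p.1 < k}) (T := {p | p.1 = k})
    (Set.disjoint_left.2 fun p h1 h2 => (h1.trans_eq h2.symm).false)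
    (Measurable.pow_const (Finset.measurable_fun_sum _ fun i hi => ?_) 3) ?_ ?_
  · rw [Finset.mem_range] at hi
    exact (hrow i L).mono (sigmaOn_mono fun p hp => hp.1.trans_lt hi) le_rfl
  · exact (hrow k L).mono (sigmaOn_mono fun p hp => hp.1) le_rfl
  · rw [integral_finsetSum _ fun ℓ _ => (hn k ℓ).memLp.integrable (by norm_num)]
    exact Finset.sum_eq_zero fun ℓ _ => h.integral_mul_eq_zero (hdisj k ℓ) (hX k ℓ) (hY k ℓ)
      (hY0 k ℓ)

end IsGaussianArray

end

/-! ### Sizes of the noise statistics. -/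

lemma sum_range_inv_sqrt_le (K : ℕ) :
    ∑ k ∈ Finset.range K, 1 / ((k : ℝ) + 1) * √((k : ℝ) + 1) ≤ 2 * √K := by
  induction K with
  | zero => simp
  | succ K ih =>
    rw [Finset.sum_range_succ]
    set a := √(K : ℝ)
    have ha : 0 ≤ a := Real.sqrt_nonneg _
    have ha2 : a ^ 2 = K := Real.sq_sqrt (by positivity)
    push_cast
    set b := √((K : ℝ) + 1)
    have hb : 0 < b := Real.sqrt_pos.2 (by positivity)
    have hb2 : b ^ 2 = K + 1 := Real.sq_sqrt (by positivity)
    rw [← hb2]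
    have e : 1 / b ^ 2 * b = 1 / b := by field_simp
    rw [e]
    have h1 : 1 / b ≤ 2 * b - 2 * a := by
      rw [div_le_iff₀ hb]
      nlinarith [sq_nonneg (b - a)]
    linarith

lemma diagSum_pow_le {r : ℝ} (h0 : 0 ≤ r) (h1 : r < 1) (L k : ℕ) :
    diagSum (fun _ ℓ => r ^ ℓ) L k ≤ 1 / (1 - r) := by
  have h2 : diagSum (fun _ ℓ => r ^ ℓ) L k ≤ ∑ j ∈ Finset.range (k + 1), r ^ (k + 1 - 1 - j) :=
    Finset.sum_le_sum fun j _ => pow_le_pow_of_le_one h0 h1.le (by omega)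
  rw [Finset.sum_range_reflect (fun i => r ^ i) (k + 1)] at h2
  refine h2.trans ?_
  rw [one_div, ← tsum_geometric_of_lt_one h0 h1]
  exact (summable_geometric_of_lt_one h0 h1).sum_le_tsum _ fun i _ => by positivity

lemma diagSum_const_one (L k : ℕ) : diagSum (fun _ _ => 1) L k = k + 1 := by
  simp [diagSum]

/-- The sum of an array over the staircase-shaped set of all indices which enter the likelihood. -/
lemma pairing_one (K L : ℕ) (a : ℕ → ℕ → ℝ) :
    pairing K L a (fun _ _ => 1) = ∑ k ∈ Finset.range K, ∑ ℓ ∈ Finset.range (L + K),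
      (if ℓ + k < L + K then 1 else 0) * a k ℓ := by
  have h1 : pairing K L a (fun _ _ => 1) =
      ∑ k ∈ Finset.range K, ∑ ℓ ∈ Finset.range (L + K - k), a k ℓ := by
    have h2 : ∀ k : ℕ, 1 / ((k : ℝ) + 1) * (diagSum a L k * diagSum (fun _ _ => 1) L k) =
        diagSum a L k := fun k => by
      rw [diagSum_const_one]; field_simp
    simp only [pairing, h2, mul_one]
    induction K with
    | zero => simp
    | succ K ih =>
      -- The new antidiagonal adds one entry to every earlier row; its last entry completes the new
      -- row to length `L + 1`.
      rw [Finset.sum_range_succ, Finset.sum_range_succ _ K, Finset.sum_range_succ _ K]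
      have h3 : ∑ k ∈ Finset.range K, ∑ ℓ ∈ Finset.range (L + (K + 1) - k), a k ℓ =
          ∑ k ∈ Finset.range K, ∑ ℓ ∈ Finset.range (L + K - k), a k ℓ +
            ∑ k ∈ Finset.range K, a k (K + L - k) := by
        rw [← Finset.sum_add_distrib]
        refine Finset.sum_congr rfl fun k hk => ?_
        rw [Finset.mem_range] at hk
        rw [show L + (K + 1) - k = L + K - k + 1 by omega, Finset.sum_range_succ,
          add_comm K L]
      rw [h3, ← ih, diagSum, Finset.sum_range_succ _ K, show L + (K + 1) - K = L + 1 by omega,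
        Finset.sum_range_succ _ L, show K + L - K = L by omega]
      ring
  rw [h1]
  refine Finset.sum_congr rfl fun k _ => ?_
  simp only [ite_mul, one_mul, zero_mul]
  rw [← Finset.sum_filter]
  congr 1
  ext ℓ
  simp only [Finset.mem_range, Finset.mem_filter]
  omega

section

variable {Ω : Type*} [MeasurableSpace Ω] {P : Measure Ω} {ξ : ℕ → ℕ → Ω → ℝ}

namespace IsGaussianArray

lemma normLe_sq_sub (h : IsGaussianArray P ξ) (K L : ℕ) :
    NormLe P (fun ω => sumSq K L (fun i j => ξ i j ω) - K * L)
      (2 * √K * (2 * √L * (gaussConst + 1))) := by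
  have := h.indep.isProbabilityMeasure
  have hG := gaussConst_nonneg
  have h1 := h.normLe_double_sum (X := fun _ _ _ => 1) (Y := fun k ℓ ω => ξ k ℓ ω ^ 2 - 1)
    (d := gaussConst + 1) (by positivity) (fun k ℓ => measurable_const)
    (fun k ℓ => ((measurable_sigmaOn (by simp)).pow_const 2).sub_const 1)
    (fun k ℓ => h.integral_sq_entry_sub k ℓ)
    (fun k ℓ => by
      have := (h.normLe_sq_entry k ℓ).add (NormLe.const (P := P) (-1))
      simpa [sub_eq_add_neg] using this) K L
  convert h1 using 2 with ω
  rw [sumSq, Finset.sum_comm]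
  simp

/-- Cancellation is needed only in the `K × L` block. Each normalised antidiagonal square is a
unit-mean square with bounded norm, so the triangle inequality costs just `O(K)`. -/
lemma normLe_quad (h : IsGaussianArray P ξ) (K L : ℕ) :
    NormLe P (fun ω => pairing K L (fun i j => ξ i j ω) (fun i j => ξ i j ω) - K * (L + 1))
      (2 * √K * (2 * √L * (gaussConst + 1)) + K * (gaussConst + 1)) := by
  have := h.indep.isProbabilityMeasure
  have h2 : NormLe P (fun ω => ∑ k ∈ Finset.range K,
      (1 / ((k : ℝ) + 1) * (diagSum (fun i j => ξ i j ω) L k) ^ 2 + -1))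
      (∑ k ∈ Finset.range K, (gaussConst + 1)) := by
    refine NormLe.sum _ fun k _ => ?_
    have h3 := ((h.normLe_sq_sum_entries (Finset.range (k + 1)) fun j => k + L - j).const_mul
      (1 / ((k : ℝ) + 1))).add (NormLe.const (P := P) (-1))
    refine h3.mono (le_of_eq ?_)
    rw [abs_of_pos (by positivity), abs_neg, abs_one, Finset.card_range]
    push_cast
    field_simp
  have h4 := (h.normLe_sq_sub K L).add h2
  convert h4 using 2 with ω
  · rw [pairing, sumSq, Finset.sum_comm (s := Finset.range L), Finset.sum_add_distrib]
    simp only [sq, Finset.sum_const, Finset.card_range, nsmul_eq_mul]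
    ring
  · rw [Finset.sum_const, Finset.card_range, nsmul_eq_mul]

/-- The weight `1 / (k + 1)` cancels the antidiagonal sum of the constant 1, leaving a plain sum of
noise over a staircase. Masking a rectangle with an indicator gives that sum the form required by
`normLe_double_sum`. -/
lemma normLe_lin (h : IsGaussianArray P ξ) (K L : ℕ) :
    NormLe P (fun ω => pairing K L (fun i j => ξ i j ω) (fun _ _ => 1))
      (2 * √K * (2 * √(L + K : ℕ) * gaussConst)) := by
  have := h.indep.isProbabilityMeasure
  simp only [pairing_one]
  refine h.normLe_double_sum (X := fun k ℓ _ => if ℓ + k < L + K then 1 else 0) (Y := ξ)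
    gaussConst_nonneg (fun k ℓ => measurable_const) (fun k ℓ => measurable_sigmaOn (by simp))
    h.integral_entry (fun k ℓ => ?_) K (L + K)
  refine (h.normLe_entry k ℓ).of_abs_le ((h.measurable k ℓ).const_mul _).aestronglyMeasurable
    fun ω => ?_
  split_ifs <;> simp

/-- In the block, the AR(1) factor uses strictly earlier entries of the row and the martingale bound
applies. On the antidiagonals the two factors may be correlated, but the crude bound `O(K)`
suffices. -/
lemma normLe_cross (h : IsGaussianArray P ξ) {ϱ : ℝ} (hϱ : |ϱ| < 1) (K L : ℕ) :
    NormLe P (fun ω => pairing K L (fun i j => ξ i j ω) (fun k => ar ϱ (fun j => ξ k j ω)))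
      (2 * √K * (2 * √L * (1 / (1 - ϱ ^ 2) * gaussConst + gaussConst))
        + K * (gaussConst + 1 / (1 - ϱ ^ 2) * gaussConst)) := by
  have := h.indep.isProbabilityMeasure
  have hm : ∀ k ℓ, Measurable fun ω => ar ϱ (fun i => ξ k i ω) ℓ := fun k ℓ =>
    (measurable_ar ϱ k ℓ).mono (h.sigmaOn_le _) le_rfl
  have h1 := h.normLe_double_sum (X := fun k ℓ ω => ar ϱ (fun i => ξ k i ω) ℓ) (Y := ξ)
    (((h.normLe_sq_ar hϱ 0 0).add (h.normLe_sq_entry 0 0)).nonneg) (measurable_ar ϱ)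
    (fun k ℓ => measurable_sigmaOn (by simp)) h.integral_entry
    (fun k ℓ => (h.normLe_sq_ar hϱ k ℓ).mul (h.normLe_sq_entry k ℓ)
      (hm k ℓ).aestronglyMeasurable (h.measurable k ℓ).aestronglyMeasurable) K L
  have h2 : NormLe P (fun ω => ∑ k ∈ Finset.range K, 1 / ((k : ℝ) + 1) *
      (diagSum (fun i j => ξ i j ω) L k * diagSum (fun k => ar ϱ (fun j => ξ k j ω)) L k))
      (∑ k ∈ Finset.range K, (gaussConst + 1 / (1 - ϱ ^ 2) * gaussConst)) := by
    refine NormLe.sum _ fun k _ => ?_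
    have h3 := ((h.normLe_sq_sum_entries (Finset.range (k + 1)) fun j => k + L - j).mul
      (h.normLe_sq_sum_ar hϱ (Finset.range (k + 1)) fun j => k + L - j)
      (Finset.measurable_fun_sum _ fun j _ => h.measurable _ _).aestronglyMeasurable
      (Finset.measurable_fun_sum _ fun j _ => hm _ _).aestronglyMeasurable).const_mul
      (1 / ((k : ℝ) + 1))
    refine h3.mono (le_of_eq ?_)
    rw [abs_of_pos (by positivity), Finset.card_range]
    push_cast
    field_simp
  have h4 := h1.add h2
  convert h4 using 2 with ω
  · rw [pairing]
    simp only [mul_comm (ar ϱ _ _)]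
  · rw [Finset.sum_const, Finset.card_range, nsmul_eq_mul]

/-- Column sums have norm `O(√K)` with summable weights `r ^ ℓ`. Antidiagonal sums have norm `O(√(k
+ 1))`, which after division by `k + 1` also adds up to `O(√K)`. -/
lemma normLe_decay (h : IsGaussianArray P ξ) {r : ℝ} (h0 : 0 ≤ r) (h1 : r < 1) (K L : ℕ) :
    NormLe P (fun ω => decayStat r K L (fun i j => ξ i j ω))
      (3 * (1 / (1 - r)) * gaussConst * √K) := by
  have hG := gaussConst_nonneg
  have hr : 0 < 1 - r := sub_pos.2 h1
  have h2 : NormLe P (fun ω => ∑ ℓ ∈ Finset.range L, r ^ ℓ * |∑ k ∈ Finset.range K, ξ k ℓ ω|)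
      (1 / (1 - r) * gaussConst * √K) := by
    have h3 := NormLe.sum (Finset.range L) fun ℓ _ =>
      ((h.normLe_sum_entries (Finset.range K) fun _ => ℓ).abs).const_mul (r ^ ℓ)
    refine h3.mono ?_
    rw [← Finset.sum_mul, Finset.card_range, mul_assoc, mul_comm gaussConst]
    gcongr
    simp only [abs_of_nonneg (pow_nonneg h0 _)]
    rw [one_div, ← tsum_geometric_of_lt_one h0 h1]
    exact (summable_geometric_of_lt_one h0 h1).sum_le_tsum _ fun i _ => by positivity
  have h4 : NormLe P (fun ω => ∑ k ∈ Finset.range K, 1 / ((k : ℝ) + 1) *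
      (|diagSum (fun i j => ξ i j ω) L k| * diagSum (fun _ ℓ => r ^ ℓ) L k))
      (1 / (1 - r) * gaussConst * (2 * √K)) := by
    have h5 := NormLe.sum (Finset.range K) fun k _ =>
      ((h.normLe_sum_entries (Finset.range (k + 1)) fun j => k + L - j).abs).const_mul
        (1 / ((k : ℝ) + 1) * diagSum (fun _ ℓ => r ^ ℓ) L k)
    have h6 : ∑ k ∈ Finset.range K, |1 / ((k : ℝ) + 1) * diagSum (fun _ ℓ => r ^ ℓ) L k| *
        (√(Finset.range (k + 1)).card * gaussConst) ≤ 1 / (1 - r) * gaussConst * (2 * √K) := by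
      calc _ ≤ ∑ k ∈ Finset.range K, 1 / (1 - r) * gaussConst *
            (1 / ((k : ℝ) + 1) * √((k : ℝ) + 1)) := by
            refine Finset.sum_le_sum fun k _ => ?_
            have hd : 0 ≤ diagSum (fun _ ℓ => r ^ ℓ) L k :=
              Finset.sum_nonneg fun _ _ => by positivity
            rw [abs_of_nonneg (by positivity), Finset.card_range]
            push_cast
            calc _ = diagSum (fun _ ℓ => r ^ ℓ) L k *
                  (gaussConst * (1 / ((k : ℝ) + 1) * √((k : ℝ) + 1))) := by ring
              _ ≤ 1 / (1 - r) * (gaussConst * (1 / ((k : ℝ) + 1) * √((k : ℝ) + 1))) := by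
                gcongr
                exact diagSum_pow_le h0 h1 L k
              _ = _ := by ring
        _ ≤ _ := by
            rw [← Finset.mul_sum]
            gcongr
            exact sum_range_inv_sqrt_le K
    convert h5.mono h6 using 2 with ω
    exact Finset.sum_congr rfl fun k _ => by rw [diagSum]; ring
  exact (h2.add h4).mono (le_of_eq (by ring))

lemma normLe_sumSq_ar (h : IsGaussianArray P ξ) {ϱ : ℝ} (hϱ : |ϱ| < 1) (K L : ℕ) :
    NormLe P (fun ω => sumSq K L (fun k => ar ϱ (fun j => ξ k j ω)))
      (L * (K * (1 / (1 - ϱ ^ 2) * gaussConst))) := by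
  have h1 := NormLe.sum (Finset.range L) fun ℓ _ => NormLe.sum (Finset.range K) fun k _ =>
    h.normLe_sq_ar hϱ k ℓ
  simpa [sumSq] using h1

lemma normLe_last (h : IsGaussianArray P ξ) {ϱ : ℝ} (hϱ : |ϱ| < 1) (K L : ℕ) :
    NormLe P (fun ω => ∑ k ∈ Finset.range K, ar ϱ (fun j => ξ k j ω) L ^ 2)
      (K * (1 / (1 - ϱ ^ 2) * gaussConst)) := by
  have h1 := NormLe.sum (Finset.range K) fun k _ => h.normLe_sq_ar hϱ k L
  simpa using h1

/-- A column sum has variance at most `K / (1 - ϱ²)`, so dividing its square by `K` leaves a bounded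
norm: centring costs `O(L)`, negligible against the total of order `K L`. -/
lemma normLe_colSq_ar (h : IsGaussianArray P ξ) {ϱ : ℝ} (hϱ : |ϱ| < 1) (K L : ℕ) :
    NormLe P (fun ω => colSq K L (fun k => ar ϱ (fun j => ξ k j ω)))
      (L * (1 / (1 - ϱ ^ 2) * gaussConst)) := by
  have h0 := (h.normLe_sq_ar hϱ 0 0).nonneg
  have h1 := NormLe.sum (P := P) (Finset.range L)
    (X := fun ℓ ω => (∑ k ∈ Finset.range K, ar ϱ (fun j => ξ k j ω) ℓ) ^ 2 / K)
    (B := fun _ => 1 / (1 - ϱ ^ 2) * gaussConst) fun ℓ _ => by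
      have h2 := (h.normLe_sq_sum_ar hϱ (Finset.range K) fun _ => ℓ).const_mul (1 / (K : ℝ))
      have h3 := h2.mono (B := 1 / (1 - ϱ ^ 2) * gaussConst) (by
        rw [abs_of_nonneg (by positivity), Finset.card_range]
        rcases Nat.eq_zero_or_pos K with rfl | hK
        · simpa using h0
        · have : (0 : ℝ) < K := by exact_mod_cast hK
          exact le_of_eq (by field_simp))
      simpa [div_eq_inv_mul] using h3
  simpa [colSq] using h1

end IsGaussianArray

/-! ### Almost sure limits and conclusion. -/

lemma ae_tendsto_div_mul_sqrt {X : ℕ → Ω → ℝ} {B : ℝ}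
    (h : ∀ᶠ n : ℕ in atTop, NormLe P (X n) (B * n)) :
    ∀ᵐ ω ∂P, Tendsto (fun n : ℕ => X n ω / (n * √n)) atTop (𝓝 0) := by
  refine ae_tendsto_zero_of_normLe (B := B) ?_
  filter_upwards [h, eventually_ge_atTop 1] with n hn h1
  have hn0 : (0 : ℝ) < n := by exact_mod_cast h1
  have hs : 0 < √(n : ℝ) := Real.sqrt_pos.2 hn0
  have := hn.const_mul (1 / (n * √n))
  rw [abs_of_pos (by positivity)] at this
  convert this using 1
  · ext ω; ring
  · field_simp

lemma ae_tendsto_div {X : ℕ → Ω → ℝ} {B : ℝ}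
    (h : ∀ᶠ n : ℕ in atTop, NormLe P (X n) (B * √n)) :
    ∀ᵐ ω ∂P, Tendsto (fun n : ℕ => X n ω / n) atTop (𝓝 0) := by
  refine ae_tendsto_zero_of_normLe (B := B) ?_
  filter_upwards [h, eventually_ge_atTop 1] with n hn h1
  have hn0 : (0 : ℝ) < n := by exact_mod_cast h1
  have hs : 0 < √(n : ℝ) := Real.sqrt_pos.2 hn0
  have := hn.const_mul (1 / n)
  rw [abs_of_pos (by positivity)] at this
  convert this using 1
  · ext ω; ring
  · have : √(n : ℝ) ^ 2 = n := Real.sq_sqrt hn0.le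
    rw [div_eq_iff hs.ne', mul_assoc, mul_assoc, ← sq, this]
    field_simp

lemma ae_tendsto_div_sq {X : ℕ → Ω → ℝ} {B : ℝ}
    (h : ∀ᶠ n : ℕ in atTop, NormLe P (X n) (B * n)) :
    ∀ᵐ ω ∂P, Tendsto (fun n : ℕ => X n ω / (n : ℝ) ^ 2) atTop (𝓝 0) := by
  filter_upwards [ae_tendsto_div_mul_sqrt h] with ω hω
  have h1 : Tendsto (fun n : ℕ => 1 / √(n : ℝ)) atTop (𝓝 0) := by
    have := (Real.tendsto_sqrt_atTop.comp
      (tendsto_natCast_atTop_atTop (R := ℝ))).inv_tendsto_atTop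
    refine this.congr fun n => ?_
    simp
  have h2 := hω.mul h1
  rw [mul_zero] at h2
  refine h2.congr fun n => ?_
  rw [div_mul_div_comm, mul_one, mul_assoc, Real.mul_self_sqrt (by positivity), sq]

/-- The statistics of the noise converge almost surely. -/
theorem IsGaussianArray.ae_noiseLimits (h : IsGaussianArray P ξ) {ϱ r : ℝ} (hϱ : |ϱ| < 1)
    (h0 : 0 ≤ r) (h1 : r < 1) (J : ℕ) {Kn Ln : ℕ → ℕ} {A : ℝ}
    (hK : ∀ᶠ n : ℕ in atTop, (Kn n : ℝ) ≤ A * n) (hL : ∀ᶠ n : ℕ in atTop, (Ln n : ℝ) ≤ A * n) :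
    ∀ᵐ ω ∂P, NoiseLimits ϱ r J Kn Ln fun i j => ξ i j ω := by
  have hG := gaussConst_nonneg
  set V := 1 / (1 - ϱ ^ 2) * gaussConst with hV
  have hV0 : 0 ≤ V := (h.normLe_sq_ar hϱ 0 0).nonneg
  have hKL : ∀ᶠ n : ℕ in atTop, √(Kn n : ℝ) * √(Ln n : ℝ) ≤ A * n := by
    filter_upwards [hK, hL] with n h2 h3
    have h4 : 0 ≤ A * n := (Nat.cast_nonneg _).trans h2
    rw [← Real.sqrt_mul (by positivity)]
    refine Real.sqrt_le_iff.2 ⟨h4, ?_⟩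
    rw [sq]
    exact mul_le_mul h2 h3 (by positivity) h4
  have hKK : ∀ᶠ n : ℕ in atTop, √(Kn n : ℝ) * √((Ln n + Kn n : ℕ) : ℝ) ≤ 2 * A * n := by
    filter_upwards [hK, hL] with n h2 h3
    have h4 : 0 ≤ A * n := (Nat.cast_nonneg _).trans h2
    rw [← Real.sqrt_mul (by positivity)]
    refine Real.sqrt_le_iff.2 ⟨by linarith, ?_⟩
    push_cast
    nlinarith [mul_le_mul h2 h3 (by positivity) h4, mul_le_mul h2 h2 (by positivity) h4]
  have s1 : ∀ᵐ ω ∂P, Tendsto (fun n : ℕ => (pairing (Kn n) (Ln n) (fun i j => ξ i j ω)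
      (fun i j => ξ i j ω) - Kn n * (Ln n + 1)) / (n * √n)) atTop (𝓝 0) := by
    refine ae_tendsto_div_mul_sqrt (B := 4 * A * (gaussConst + 1) + A * (gaussConst + 1)) ?_
    filter_upwards [hK, hKL] with n h2 h3
    refine (h.normLe_quad (Kn n) (Ln n)).mono ?_
    nlinarith [mul_le_mul_of_nonneg_right h2 (by positivity : 0 ≤ gaussConst + 1),
      mul_le_mul_of_nonneg_right h3 (by positivity : 0 ≤ gaussConst + 1)]
  have s2 : ∀ᵐ ω ∂P, Tendsto (fun n : ℕ => pairing (Kn n) (Ln n) (fun i j => ξ i j ω)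
      (fun _ _ => 1) / (n * √n)) atTop (𝓝 0) := by
    refine ae_tendsto_div_mul_sqrt (B := 8 * A * gaussConst) ?_
    filter_upwards [hKK] with n h3
    refine (h.normLe_lin (Kn n) (Ln n)).mono ?_
    nlinarith [mul_le_mul_of_nonneg_right h3 hG]
  have s3 : ∀ᵐ ω ∂P, Tendsto (fun n : ℕ => pairing (Kn n) (Ln n) (fun i j => ξ i j ω)
      (fun k => ar ϱ (fun j => ξ k j ω)) / (n * √n)) atTop (𝓝 0) := by
    refine ae_tendsto_div_mul_sqrt (B := 4 * A * (V + gaussConst) + A * (gaussConst + V)) ?_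
    filter_upwards [hK, hKL] with n h2 h3
    refine (h.normLe_cross hϱ (Kn n) (Ln n)).mono ?_
    nlinarith [mul_le_mul_of_nonneg_right h2 (by positivity : 0 ≤ gaussConst + V),
      mul_le_mul_of_nonneg_right h3 (by positivity : 0 ≤ V + gaussConst)]
  have s4 : ∀ᵐ ω ∂P, Tendsto (fun n : ℕ => decayStat r (Kn n) (Ln n) (fun i j => ξ i j ω) / n)
      atTop (𝓝 0) := by
    refine ae_tendsto_div (B := 3 * (1 / (1 - r)) * gaussConst * √A) ?_
    filter_upwards [hK] with n h2
    refine (h.normLe_decay h0 h1 (Kn n) (Ln n)).mono ?_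
    have hr : 0 < 1 - r := sub_pos.2 h1
    rw [mul_assoc _ √A, ← Real.sqrt_mul' A (Nat.cast_nonneg n)]
    gcongr
  have s5 : ∀ᵐ ω ∂P, Tendsto (fun n : ℕ => (sumSq (Kn n) (Ln n) (fun i j => ξ i j ω)
      - Kn n * Ln n) / (n : ℝ) ^ 2) atTop (𝓝 0) := by
    refine ae_tendsto_div_sq (B := 4 * A * (gaussConst + 1)) ?_
    filter_upwards [hKL] with n h3
    refine (h.normLe_sq_sub (Kn n) (Ln n)).mono ?_
    nlinarith [mul_le_mul_of_nonneg_right h3 (by positivity : 0 ≤ gaussConst + 1)]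
  have s6 : ∀ᵐ ω ∂P, Tendsto (fun n : ℕ => colSq (Kn n) (Ln n)
      (fun k => ar ϱ (fun j => ξ k j ω)) / (n : ℝ) ^ 2) atTop (𝓝 0) := by
    refine ae_tendsto_div_sq (B := A * V) ?_
    filter_upwards [hL] with n h3
    refine (h.normLe_colSq_ar hϱ (Kn n) (Ln n)).mono ?_
    nlinarith [mul_le_mul_of_nonneg_right h3 hV0]
  have s7 : ∀ᵐ ω ∂P, Tendsto (fun n : ℕ => sumSq (Kn n) (J + 1)
      (fun k => ar ϱ (fun j => ξ k j ω)) / (n : ℝ) ^ 2) atTop (𝓝 0) := by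
    refine ae_tendsto_div_sq (B := (J + 1) * (A * V)) ?_
    filter_upwards [hK] with n h3
    refine (h.normLe_sumSq_ar hϱ (Kn n) (J + 1)).mono ?_
    have h4 := mul_le_mul_of_nonneg_left (mul_le_mul_of_nonneg_right h3 hV0)
      (by positivity : (0 : ℝ) ≤ J + 1)
    push_cast
    linarith
  have s8 : ∀ᵐ ω ∂P, Tendsto (fun n : ℕ => (∑ k ∈ Finset.range (Kn n),
      ar ϱ (fun j => ξ k j ω) (Ln n) ^ 2) / (n : ℝ) ^ 2) atTop (𝓝 0) := by
    refine ae_tendsto_div_sq (B := A * V) ?_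
    filter_upwards [hK] with n h3
    refine (h.normLe_last hϱ (Kn n) (Ln n)).mono ?_
    nlinarith [mul_le_mul_of_nonneg_right h3 hV0]
  filter_upwards [s1, s2, s3, s4, s5, s6, s7, s8] with ω t1 t2 t3 t4 t5 t6 t7 t8
  exact ⟨t1, t2, t3, t4, t5, t6, t7, t8⟩

lemma eventually_linear_bounds {a : ℕ → ℕ} {K : ℝ} (hK : 0 < K)
    (h : (fun n : ℕ => (a n : ℝ) - n * K) =o[atTop] fun n : ℕ => (n : ℝ)) :
    (∀ᶠ n : ℕ in atTop, K / 2 * n ≤ a n) ∧ ∀ᶠ n : ℕ in atTop, (a n : ℝ) ≤ 3 * K / 2 * n := by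
  have h1 := h.bound (show 0 < K / 2 by positivity)
  constructor <;>
  · filter_upwards [h1] with n hn
    rw [Real.norm_eq_abs, Real.norm_eq_abs, Nat.abs_cast, abs_le] at hn
    linarith [hn.1, hn.2]

end

end HJM

end

theorem theorem2p1 {Ω : Type*} [MeasurableSpace Ω] (P : Measure Ω) [IsProbabilityMeasure P]
    (J : ℕ) (H : Set (HJM.Param J)) (hH : IsCompact H)
    (hβ : ∀ θ ∈ H, θ.1 ≠ 0) (hϱ : ∀ θ ∈ H, θ.2.1 ∈ Set.Ioo (-1 : ℝ) 1)
    -- the true parameters; the likelihood cannot tell `(β, ϱ, b)` from `(-β, ϱ, -b)`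
    (θ₀ : HJM.Param J) (hθ₀ : θ₀ ∈ H) (hid : (-θ₀.1, θ₀.2.1, -θ₀.2.2) ∉ H)
    (f₀ : ℕ → ℝ) (α η f : ℕ → ℕ → Ω → ℝ) (hf : HJM.IsModel P θ₀ f₀ α η f)
    (Kn Ln : ℕ → ℕ) (hKn : ∀ n, 1 ≤ n → 0 < Kn n) (hLn : ∀ n, 1 ≤ n → 0 < Ln n)
    (K L : ℝ) (hK : 0 < K) (hL : 0 < L)
    (hKlim : (fun n : ℕ => (Kn n : ℝ) - n * K) =o[atTop] fun n : ℕ => (n : ℝ))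
    (hLlim : (fun n : ℕ => (Ln n : ℝ) - n * L) =o[atTop] fun n : ℕ => (n : ℝ))
    (θhat : ℕ → Ω → HJM.Param J)
    (hθhat : ∀ n, 1 ≤ n → ∀ᵐ ω ∂P,
      HJM.IsMLE H (Kn n) (Ln n) (fun k ℓ => f k ℓ ω) (θhat n ω)) :
    ∀ᵐ ω ∂P, Tendsto (fun n => θhat n ω) atTop (𝓝 θ₀) := by
  obtain ⟨R, r₀, r, hb⟩ := HJM.exists_paramBounds hH ⟨θ₀, hθ₀⟩ hβ hϱ
  obtain ⟨hK1, hK2⟩ := HJM.eventually_linear_bounds hK hKlim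
  obtain ⟨hL1, hL2⟩ := HJM.eventually_linear_bounds hL hLlim
  have hup : ∀ {a : ℕ → ℕ} {B : ℝ}, B ≤ max (3 * K / 2) (3 * L / 2) →
      (∀ᶠ n : ℕ in atTop, (a n : ℝ) ≤ B * n) →
      ∀ᶠ n : ℕ in atTop, (a n : ℝ) ≤ max (3 * K / 2) (3 * L / 2) * n := fun hB h =>
    h.mono fun n hn => hn.trans (mul_le_mul_of_nonneg_right hB (Nat.cast_nonneg n))
  have hlow : ∀ {a : ℕ → ℕ} {B : ℝ}, min (K / 2) (L / 2) ≤ B →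
      (∀ᶠ n : ℕ in atTop, B * n ≤ (a n : ℝ)) →
      ∀ᶠ n : ℕ in atTop, min (K / 2) (L / 2) * n ≤ (a n : ℝ) := fun hB h =>
    h.mono fun n hn => (mul_le_mul_of_nonneg_right hB (Nat.cast_nonneg n)).trans hn
  have hlim := hf.noise.isGaussianArray.ae_noiseLimits (ϱ := θ₀.2.1) (r := r)
    ((hb.auto_le θ₀ hθ₀).trans_lt (hb.lt.trans hb.lt_one)) hb.pos.le hb.lt_one J
    (hup (le_max_left _ _) hK2) (hup (le_max_right _ _) hL2)
  -- Countably many null sets are discarded at once, so the deterministic theorem can be applied for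
  -- each fixed `ω`.
  have hmle : ∀ᵐ ω ∂P, ∀ n, 1 ≤ n →
      HJM.IsMLE H (Kn n) (Ln n) (fun k ℓ => f k ℓ ω) (θhat n ω) :=
    ae_all_iff.2 fun n => by
      by_cases hn : 1 ≤ n
      · filter_upwards [hθhat n hn] with ω hω _ using hω
      · exact .of_forall fun ω h => absurd h hn
  filter_upwards [hf.forward_increment, hlim, hmle] with ω h1 h2 h3
  exact HJM.tendsto_of_noiseLimits hH hb hθ₀ hid
    (lt_min (by positivity : 0 < K / 2) (by positivity : 0 < L / 2))
    (hlow (min_le_left _ _) hK1) (hlow (min_le_right _ _) hL1) h1 h2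
    ((eventually_ge_atTop 1).mono h3)
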